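/- Let $p,r\in L_2(0,1)$ be real-valued. For $y$ absolutely continuous on $[0,1]$ put $y^{[1]}:=y'-ry$ and, if $y^{[1]}$ is absolutely continuous on $[0,1]$, $\ell(y):=-(y^{[1]})'-ry^{[1]}-r^2y$ (so that $\ell(y)=-y''+qy$ with $q=r'$). Let $A_1$, $A_2$ be the operators $A_jy=\ell(y)$ in the complex space $L_2(0,1)$ on the sets of those $y$ with $y,y^{[1]}$ absolutely continuous on $[0,1]$, $\ell(y)\in L_2(0,1)$, and $y(0)=y^{[1]}(1)=0$ for $j=1$, $y(0)=y(1)=0$ for $j=2$. Let $B$ be multiplication by $p$, and let $T_j(p,r)(\lambda):=\lambda^2I-2\lambda B-A_j$, $\lambda\in\mathbb C$, on $\operatorname{dom}A_j$. The spectrum $\sigma(T_j(p,r))$ of this pencil is the set of $\lambda\in\mathbb C$ for which $T_j(p,r)(\lambda)$ is not boundedly invertible, and a nonzero $y\in\operatorname{dom}A_j$ is an eigenfunction for $\lambda$ if $T_j(p,r)(\lambda)y=0$. Assume (A): $\mu_*\in\mathbb R$ is such that $T_1(p,r)(\mu_*)$ is negative, i.e. $(T_1(p,r)(\mu_*)y,y)<0$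 for every nonzero $y\in\operatorname{dom}A_1$. Then the problem $\ell(z)=\mu_*^2z-2\mu_*pz$, $z(1)=1$, $z^{[1]}(1)=0$ has a real solution $z$, and every real solution $z$ of it is strictly positive on $[0,1]$. Set $v:=z'/z$, $$J:=\begin{pmatrix}0&1\\-1&0\end{pmatrix},\qquad P:=\begin{pmatrix}\mu_*&-v\\-v&2p-\mu_*\end{pmatrix},$$ and let $\mathcal D_j(P)$, $j=1,2$, be the Dirac operator $\mathbf u\mapsto J\mathbf u'+P\mathbf u$ in $L_2(0,1)\times L_2(0,1)$ on the domain $\{\mathbf u=(u_1,u_2)^{\mathrm t}\in W_2^1(0,1)\times W_2^1(0,1)\mid u_2(0)=u_j(1)=0\}$. Then $$\sigma(\mathcal D_1(P))=\sigma(T_1(p,r)),\qquad \sigma(\mathcal D_2(P))=\sigma(T_2(p,r))\cup\{\mu_*\}.$$ Moreover, for $j=1,2$, $\lambda\in\mathbb C$ and $y$ absolutely continuous on $[0,1]$, $y$ is an eigenfunction of $T_j(p,r)$ corresponding to $\lambda$ if and only if $\lambda\ne\mu_*$ and $\mathbf u=(u_1,u_2)^{\mathrm t}$ with $u_1:=(y'-vy)/(\lambda-\mu_*)$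 and $u_2:=y$ is an eigenfunction of $\mathcal D_j(P)$ corresponding to $\lambda$. -/

import Mathlib

open MeasureTheory Set Filter
open scoped Topology ENNReal

noncomputable section

namespace EnergyPencil

/-! ### Operator-theoretic notions -/

section Operators

variable {E : Type*} [NormedAddCommGroup E] [NormedSpace ℂ E]

/-- The identity operator, as an everywhere defined partial linear map. -/
def idOp (E : Type*) [NormedAddCommGroup E] [NormedSpace ℂ E] : E →ₗ.[ℂ] E :=
  (LinearMap.id : E →ₗ[ℂ] E).toPMap ⊤

/-- An (unbounded) operator is boundedly invertible if it is a bijection of its domain onto the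
whole space with bounded inverse `S`. -/
def BoundedlyInvertible (T : E →ₗ.[ℂ] E) : Prop :=
  ∃ S : E →L[ℂ] E, (∀ f : E, (S f, f) ∈ T.graph) ∧ ∀ y : T.domain, S (T y) = y

/-- The spectrum of an (unbounded) operator. -/
def opSpectrum (T : E →ₗ.[ℂ] E) : Set ℂ :=
  {l | ¬ BoundedlyInvertible (T - l • idOp E)}

/-- `u` is an eigenvector of the operator `T` for the eigenvalue `l`. -/
def IsEigenvector (T : E →ₗ.[ℂ] E) (l : ℂ) (u : E) : Prop :=
  u ≠ 0 ∧ ∃ h : u ∈ T.domain, T ⟨u, h⟩ = l • u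

/-- The spectrum of an operator pencil. -/
def pencilSpectrum (T : ℂ → (E →ₗ.[ℂ] E)) : Set ℂ :=
  {l | 0 ∈ opSpectrum (T l)}

/-- `y` is an eigenvector of the operator pencil `T` for the eigenvalue `l`. -/
def IsPencilEigenvector (T : ℂ → (E →ₗ.[ℂ] E)) (l : ℂ) (y : E) : Prop :=
  y ≠ 0 ∧ ∃ h : y ∈ (T l).domain, T l ⟨y, h⟩ = 0

end Operators

/-- A (symmetric) operator is negative if `(T y, y) < 0` for every nonzero `y` in its domain. -/
def IsNegative {H : Type*} [NormedAddCommGroup H] [InnerProductSpace ℂ H]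
    (T : H →ₗ.[ℂ] H) : Prop :=
  ∀ y : T.domain, (y : H) ≠ 0 → (inner ℂ (T y) (y : H)).re < 0

/-! ### Function spaces on `(0,1)` -/

/-- Lebesgue measure on `(0,1)`. -/
abbrev vol01 : Measure ℝ := volume.restrict (Ioo 0 1)

/-- The Hilbert space `L₂(0,1)` of complex-valued functions. -/
abbrev L2 : Type := Lp ℂ 2 vol01

/-- The Hilbert space `L₂(0,1) × L₂(0,1)`. -/
abbrev L2xL2 : Type := WithLp 2 (L2 × L2)

theorem ac_zero : AbsolutelyContinuousOnInterval (0 : ℝ → ℂ) 0 1 :=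
  ((LipschitzWith.const (0 : ℂ)).lipschitzOnWith (s := uIcc (0 : ℝ) 1)).absolutelyContinuousOnInterval

theorem eqOn_of_ac {E : Type*} [NormedAddCommGroup E] {f g : ℝ → E}
    (hf : AbsolutelyContinuousOnInterval f 0 1) (hg : AbsolutelyContinuousOnInterval g 0 1)
    (h : f =ᵐ[vol01] g) : EqOn f g (Icc 0 1) := by
  have hf' := hf.continuousOn
  have hg' := hg.continuousOn
  rw [uIcc_of_le zero_le_one] at hf' hg'
  exact Measure.eqOn_Icc_of_ae_eq volume zero_ne_one
    (h.filter_mono (ae_mono (Measure.restrict_mono_ae Ioo_ae_eq_Icc.symm.le))) hf' hg'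

theorem hasDerivAt_eq_zero {E : Type*} [NormedAddCommGroup E] [NormedSpace ℝ E] {f : ℝ → E}
    {f' : E} {x : ℝ} (h : EqOn f 0 (Icc 0 1)) (hx : x ∈ Ioo (0 : ℝ) 1) (hd : HasDerivAt f f' x) :
    f' = 0 := by
  have h0 : HasDerivAt f 0 x := by
    refine (hasDerivAt_const x (0 : E)).congr_of_eventuallyEq ?_
    filter_upwards [isOpen_Ioo.mem_nhds hx] with t ht
    exact h (Ioo_subset_Icc_self ht)
  exact hd.unique h0

/-! ### Boundary conditions -/

/-- The index `j ∈ {1, 2}` of the two boundary value problems. -/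
inductive BC
  | one
  | two

/-- The `j`-th entry of a pair. -/
def BC.pick : BC → ℂ → ℂ → ℂ
  | .one, a, _ => a
  | .two, _, b => b

theorem BC.pick_add (j : BC) (a b c d : ℂ) :
    j.pick (a + c) (b + d) = j.pick a b + j.pick c d := by cases j <;> rfl

theorem BC.pick_smul (j : BC) (l a b : ℂ) :
    j.pick (l • a) (l • b) = l • j.pick a b := by cases j <;> rfl

theorem BC.pick_zero (j : BC) : j.pick 0 0 = 0 := by cases j <;> rfl

/-! ### Sturm--Liouville operators with potential `q = r'` -/

/-- The functions `y` and `w` are absolutely continuous on `[0,1]`, `w` is the quasi-derivative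
`y^{[1]} = y' - r y`, and `f = ℓ(y) = -(y^{[1]})' - r y^{[1]} - r² y`
(equalities almost everywhere on `(0,1)`). -/
structure IsEll {E : Type*} [NormedAddCommGroup E] [NormedSpace ℝ E]
    (r : ℝ → ℝ) (y w f : ℝ → E) : Prop where
  ac_y : AbsolutelyContinuousOnInterval y 0 1
  ac_w : AbsolutelyContinuousOnInterval w 0 1
  deriv_y : ∀ᵐ x ∂vol01, HasDerivAt y (w x + r x • y x) x
  deriv_w : ∀ᵐ x ∂vol01, HasDerivAt w (-f x - r x • w x - (r x) ^ 2 • y x) x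

/-- The graph of the Sturm--Liouville operator `A_j`: the pairs `(y, ℓ(y))` with `y ∈ dom ℓ`,
`y(0) = 0` and `y^{[1]}(1) = 0` (for `j = 1`), `y(1) = 0` (for `j = 2`). -/
def slGraph (r : ℝ → ℝ) (j : BC) : Submodule ℂ (L2 × L2) where
  carrier := {Y | ∃ y w : ℝ → ℂ, Y.1 =ᵐ[vol01] y ∧ IsEll r y w Y.2 ∧
    y 0 = 0 ∧ j.pick (w 1) (y 1) = 0}
  zero_mem' := by
    have h0 := ac_zero
    refine ⟨0, 0, Lp.coeFn_zero _ _ _, ⟨h0, h0, ?_, ?_⟩, rfl, j.pick_zero⟩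
    · filter_upwards with x
      refine (hasDerivAt_const x (0 : ℂ)).congr_deriv ?_
      simp
    · filter_upwards [AEEqFun.coeFn_zero (μ := vol01) (β := ℂ)] with x hx
      refine (hasDerivAt_const x (0 : ℂ)).congr_deriv ?_
      simp [hx]
  add_mem' := by
    rintro ⟨a, b⟩ ⟨a', b'⟩ ⟨y, w, h1, h2, h3, h4⟩ ⟨y', w', h1', h2', h3', h4'⟩
    refine ⟨y + y', w + w', (Lp.coeFn_add _ _).trans (h1.add h1'),
      ⟨h2.ac_y.add h2'.ac_y, h2.ac_w.add h2'.ac_w, ?_, ?_⟩, by simp [h3, h3'], ?_⟩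
    · filter_upwards [h2.deriv_y, h2'.deriv_y] with x hx hx'
      refine (hx.add hx').congr_deriv ?_
      simp only [Pi.add_apply, smul_add]; abel
    · filter_upwards [h2.deriv_w, h2'.deriv_w, Lp.coeFn_add b b'] with x hx hx' hb
      refine (hx.add hx').congr_deriv ?_
      simp only [Prod.mk_add_mk, hb, Pi.add_apply, smul_add]; abel
    · simp only [Pi.add_apply, BC.pick_add, h4, h4', add_zero]
  smul_mem' := by
    rintro c ⟨a, b⟩ ⟨y, w, h1, h2, h3, h4⟩
    refine ⟨c • y, c • w, (Lp.coeFn_smul _ _).trans (h1.const_smul c),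
      ⟨h2.ac_y.const_smul c, h2.ac_w.const_smul c, ?_, ?_⟩, by simp [h3], ?_⟩
    · filter_upwards [h2.deriv_y] with x hx
      refine (hx.const_smul c).congr_deriv ?_
      simp only [Pi.smul_apply, smul_add, smul_comm c]
    · filter_upwards [h2.deriv_w, Lp.coeFn_smul c b] with x hx hb
      refine (hx.const_smul c).congr_deriv ?_
      simp only [Prod.smul_mk, hb, Pi.smul_apply, smul_sub, smul_neg, smul_comm c]
    · simp only [Pi.smul_apply, BC.pick_smul, h4, smul_zero]

/-- The Sturm--Liouville operator `A_j`. -/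
def slOp (r : ℝ → ℝ) (j : BC) : L2 →ₗ.[ℂ] L2 := (slGraph r j).toLinearPMap

theorem slOp_graph (r : ℝ → ℝ) (j : BC) : (slOp r j).graph = slGraph r j := by
  refine Submodule.toLinearPMap_graph_eq _ ?_
  rintro ⟨a, b⟩ ⟨y, w, h1, h2, -, -⟩ (h0 : a = 0)
  subst h0
  have h0 := ac_zero
  have hy : EqOn y 0 (Icc 0 1) := eqOn_of_ac h2.ac_y h0 (h1.symm.trans (Lp.coeFn_zero _ _ _))
  have hw : EqOn w 0 (Icc 0 1) := by
    refine eqOn_of_ac h2.ac_w h0 ?_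
    filter_upwards [h2.deriv_y, ae_restrict_mem measurableSet_Ioo] with x hx hx1
    have := hasDerivAt_eq_zero hy hx1 hx
    simpa [hy (Ioo_subset_Icc_self hx1)] using this
  refine (Lp.eq_zero_iff_ae_eq_zero).2 ?_
  filter_upwards [h2.deriv_w, ae_restrict_mem measurableSet_Ioo] with x hx hx1
  have := hasDerivAt_eq_zero hw hx1 hx
  simpa [hy (Ioo_subset_Icc_self hx1), hw (Ioo_subset_Icc_self hx1)] using this

/-! ### Multiplication operators and the quadratic pencils -/

/-- The graph of the maximal operator of multiplication by `p` in `L₂(0,1)`. -/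
def mulGraph (p : ℝ → ℝ) : Submodule ℂ (L2 × L2) where
  carrier := {Y | ∀ᵐ x ∂vol01, Y.2 x = p x • Y.1 x}
  zero_mem' := by
    filter_upwards [AEEqFun.coeFn_zero (μ := vol01) (β := ℂ)] with x hx
    simp [hx]
  add_mem' := by
    rintro ⟨a, b⟩ ⟨a', b'⟩ h h'
    filter_upwards [h, h', Lp.coeFn_add b b', Lp.coeFn_add a a'] with x hx hx' hb ha
    simp only [Prod.mk_add_mk, hb, ha, Pi.add_apply, smul_add] at hx hx' ⊢
    rw [hx, hx']
  smul_mem' := by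
    rintro c ⟨a, b⟩ h
    filter_upwards [h, Lp.coeFn_smul c b, Lp.coeFn_smul c a] with x hx hb ha
    simp only [Prod.smul_mk, hb, ha, Pi.smul_apply] at hx ⊢
    rw [hx, smul_comm]

/-- The operator `B` of multiplication by `p`. -/
def mulOp (p : ℝ → ℝ) : L2 →ₗ.[ℂ] L2 := (mulGraph p).toLinearPMap

theorem mulOp_graph (p : ℝ → ℝ) : (mulOp p).graph = mulGraph p := by
  refine Submodule.toLinearPMap_graph_eq _ ?_
  rintro ⟨a, b⟩ h (h0 : a = 0)
  subst h0
  refine (Lp.eq_zero_iff_ae_eq_zero).2 ?_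
  filter_upwards [h, AEEqFun.coeFn_zero (μ := vol01) (β := ℂ)] with x hx h0
  simpa [h0] using hx

/-- The quadratic operator pencil `T_j(p,r)(l) = l² I - 2 l B - A_j`. -/
def pencil (p r : ℝ → ℝ) (j : BC) (l : ℂ) : L2 →ₗ.[ℂ] L2 :=
  l ^ 2 • idOp L2 - (2 * l) • mulOp p - slOp r j

/-- The domain of `T_j(p,r)(l)` is `dom A_j`. -/
theorem pencil_domain (p r : ℝ → ℝ) (hp : MemLp p 2 vol01) (j : BC) (l : ℂ) :
    (pencil p r j l).domain = (slOp r j).domain := by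
  have hB : (slOp r j).domain ≤ (mulOp p).domain := by
    intro a ha
    obtain ⟨b, hb⟩ := LinearPMap.mem_domain_iff.1 ha
    rw [slOp_graph] at hb
    obtain ⟨y, w, h1, h2, -, -⟩ := hb
    obtain ⟨C, hC⟩ := h2.ac_y.exists_bound
    have hm : MemLp (fun x => p x • y x) 2 vol01 := by
      have hy : AEStronglyMeasurable y vol01 := (Lp.aestronglyMeasurable a).congr h1
      refine MemLp.of_le_mul (c := C) hp (hp.1.smul hy) ?_
      filter_upwards [ae_restrict_mem measurableSet_Ioo] with x hx
      rw [norm_smul, mul_comm]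
      refine mul_le_mul_of_nonneg_right (hC x ?_) (norm_nonneg _)
      rw [uIcc_of_le zero_le_one]
      exact Ioo_subset_Icc_self hx
    refine LinearPMap.mem_domain_iff.2 ⟨hm.toLp _, ?_⟩
    rw [mulOp_graph]
    change ∀ᵐ x ∂vol01, _
    filter_upwards [hm.coeFn_toLp, h1] with x hx hx1
    rw [hx, hx1]
  change (⊤ ⊓ (mulOp p).domain) ⊓ (slOp r j).domain = _
  rw [top_inf_eq]
  exact inf_eq_right.2 hB

/-! ### Dirac operators -/

/-- The matrix `J`. -/
def J : Matrix (Fin 2) (Fin 2) ℂ := !![0, 1; -1, 0]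

/-- `u ∈ W₂¹(0,1)`: absolutely continuous on `[0,1]`, with derivative `u' ∈ L₂(0,1)`. -/
structure IsW12 (u u' : ℝ → ℂ) : Prop where
  ac : AbsolutelyContinuousOnInterval u 0 1
  hasDeriv : ∀ᵐ x ∂vol01, HasDerivAt u (u' x) x
  memLp : MemLp u' 2 vol01

/-- The graph of the Dirac operator `D_j(P)`: the pairs `(u, J u' + P u)` with
`u = (u₁, u₂) ∈ W₂¹(0,1) × W₂¹(0,1)` and `u₂(0) = u_j(1) = 0`. -/
def diracGraph (P : ℝ → Matrix (Fin 2) (Fin 2) ℂ) (j : BC) : Submodule ℂ (L2xL2 × L2xL2) where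
  carrier := {U | ∃ u₁ u₂ u₁' u₂' : ℝ → ℂ, U.1.fst =ᵐ[vol01] u₁ ∧ U.1.snd =ᵐ[vol01] u₂ ∧
    IsW12 u₁ u₁' ∧ IsW12 u₂ u₂' ∧ u₂ 0 = 0 ∧ j.pick (u₁ 1) (u₂ 1) = 0 ∧
    ∀ᵐ x ∂vol01, ![U.2.fst x, U.2.snd x] =
      J.mulVec ![u₁' x, u₂' x] + (P x).mulVec ![u₁ x, u₂ x]}
  zero_mem' := by
    have h0 : IsW12 (0 : ℝ → ℂ) 0 :=
      ⟨ac_zero,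
        by filter_upwards with x; exact hasDerivAt_const x (0 : ℂ), MemLp.zero⟩
    refine ⟨0, 0, 0, 0, Lp.coeFn_zero _ _ _, Lp.coeFn_zero _ _ _, h0, h0, rfl, j.pick_zero, ?_⟩
    filter_upwards [AEEqFun.coeFn_zero (μ := vol01) (β := ℂ)] with x hx
    have e : (![0, 0] : Fin 2 → ℂ) = 0 := by ext i; fin_cases i <;> rfl
    simp [hx, e]
  add_mem' := by
    rintro ⟨a, b⟩ ⟨c, d⟩ ⟨u₁, u₂, u₁', u₂', h1, h2, h3, h4, h5, h6, h7⟩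
      ⟨v₁, v₂, v₁', v₂', k1, k2, k3, k4, k5, k6, k7⟩
    refine ⟨u₁ + v₁, u₂ + v₂, u₁' + v₁', u₂' + v₂', (Lp.coeFn_add _ _).trans (h1.add k1),
      (Lp.coeFn_add _ _).trans (h2.add k2), ⟨h3.ac.add k3.ac, ?_, h3.memLp.add k3.memLp⟩,
      ⟨h4.ac.add k4.ac, ?_, h4.memLp.add k4.memLp⟩, by simp [h5, k5], ?_, ?_⟩
    · filter_upwards [h3.hasDeriv, k3.hasDeriv] with x hx kx using hx.add kx
    · filter_upwards [h4.hasDeriv, k4.hasDeriv] with x hx kx using hx.add kx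
    · simp only [Pi.add_apply, BC.pick_add, h6, k6, add_zero]
    · filter_upwards [h7, k7, Lp.coeFn_add b.fst d.fst, Lp.coeFn_add b.snd d.snd]
        with x hx kx e1 e2
      have e (s t s' t' : ℂ) : ![s + s', t + t'] = ![s, t] + ![s', t'] := by simp
      simp only [Prod.mk_add_mk, WithLp.add_fst, WithLp.add_snd, e1, e2, Pi.add_apply, e,
        Matrix.mulVec_add] at hx kx ⊢
      rw [hx, kx]; abel
  smul_mem' := by
    rintro c ⟨a, b⟩ ⟨u₁, u₂, u₁', u₂', h1, h2, h3, h4, h5, h6, h7⟩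
    refine ⟨c • u₁, c • u₂, c • u₁', c • u₂', (Lp.coeFn_smul _ _).trans (h1.const_smul c),
      (Lp.coeFn_smul _ _).trans (h2.const_smul c),
      ⟨h3.ac.const_smul c, ?_, h3.memLp.const_smul c⟩,
      ⟨h4.ac.const_smul c, ?_, h4.memLp.const_smul c⟩, by simp [h5], ?_, ?_⟩
    · filter_upwards [h3.hasDeriv] with x hx using hx.const_smul c
    · filter_upwards [h4.hasDeriv] with x hx using hx.const_smul c
    · simp only [Pi.smul_apply, BC.pick_smul, h6, smul_zero]
    · filter_upwards [h7, Lp.coeFn_smul c b.fst, Lp.coeFn_smul c b.snd] with x hx e1 e2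
      have e (s t : ℂ) : ![c • s, c • t] = c • ![s, t] := by simp
      simp only [Prod.smul_mk, WithLp.smul_fst, WithLp.smul_snd, e1, e2, Pi.smul_apply, e,
        Matrix.mulVec_smul] at hx ⊢
      rw [hx, smul_add]

/-- The Dirac operator `D_j(P)`. -/
def diracOp (P : ℝ → Matrix (Fin 2) (Fin 2) ℂ) (j : BC) : L2xL2 →ₗ.[ℂ] L2xL2 :=
  (diracGraph P j).toLinearPMap

theorem diracOp_graph (P : ℝ → Matrix (Fin 2) (Fin 2) ℂ) (j : BC) :
    (diracOp P j).graph = diracGraph P j := by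
  refine Submodule.toLinearPMap_graph_eq _ ?_
  rintro ⟨a, b⟩ ⟨u₁, u₂, u₁', u₂', h1, h2, h3, h4, -, -, h7⟩ (h0 : a = 0)
  subst h0
  have h0 := ac_zero
  have e1 : EqOn u₁ 0 (Icc 0 1) := eqOn_of_ac h3.ac h0 (h1.symm.trans (Lp.coeFn_zero _ _ _))
  have e2 : EqOn u₂ 0 (Icc 0 1) := eqOn_of_ac h4.ac h0 (h2.symm.trans (Lp.coeFn_zero _ _ _))
  have key : ∀ᵐ x ∂vol01, b.fst x = 0 ∧ b.snd x = 0 := by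
    filter_upwards [h7, h3.hasDeriv, h4.hasDeriv, ae_restrict_mem measurableSet_Ioo]
      with x hx hx1 hx2 hm
    have d1 := hasDerivAt_eq_zero e1 hm hx1
    have d2 := hasDerivAt_eq_zero e2 hm hx2
    have c1 : u₁ x = 0 := e1 (Ioo_subset_Icc_self hm)
    have c2 : u₂ x = 0 := e2 (Ioo_subset_Icc_self hm)
    have e : (![0, 0] : Fin 2 → ℂ) = 0 := by ext i; fin_cases i <;> rfl
    simp only [d1, d2, c1, c2, e, Matrix.mulVec_zero, add_zero] at hx
    exact ⟨by simpa using congrFun hx 0, by simpa using congrFun hx 1⟩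
  have b1 : b.fst = 0 := (Lp.eq_zero_iff_ae_eq_zero).2 (key.mono fun x hx => hx.1)
  have b2 : b.snd = 0 := (Lp.eq_zero_iff_ae_eq_zero).2 (key.mono fun x hx => hx.2)
  exact (WithLp.ofLp_injective 2) (Prod.ext b1 b2)

/-! ### The Dirac potential of the Miura factorization -/

/-- `z` is a (real) solution of `-z'' + q z + 2 m p z = m² z` on `(0,1)`, i.e. of
`ℓ(z) = m² z - 2 m p z`, with `z(1) = 1` and `z^{[1]}(1) = 0`. -/
def IsMiuraSolution (p r : ℝ → ℝ) (m : ℝ) (z : ℝ → ℝ) : Prop :=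
  ∃ w : ℝ → ℝ, IsEll r z w (fun x => m ^ 2 * z x - 2 * m * p x * z x) ∧ z 1 = 1 ∧ w 1 = 0

/-- The logarithmic derivative `v = z' / z`. -/
def miuraV (z : ℝ → ℝ) (x : ℝ) : ℝ := deriv z x / z x

/-- The Dirac potential `P` with rows `(m, -v)` and `(-v, 2p - m)`. -/
def miuraP (p : ℝ → ℝ) (m : ℝ) (z : ℝ → ℝ) (x : ℝ) : Matrix (Fin 2) (Fin 2) ℂ :=
  !![(m : ℂ), -(miuraV z x : ℂ); -(miuraV z x : ℂ), 2 * (p x : ℂ) - (m : ℂ)]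

/-! ### Eigenfunctions -/

/-- The function `y` belongs to `L₂(0,1)` and (its class) is an eigenfunction of `T_j(p,r)`. -/
def IsPencilEigenfunction (p r : ℝ → ℝ) (j : BC) (l : ℂ) (y : ℝ → ℂ) : Prop :=
  ∃ hy : MemLp y 2 vol01, IsPencilEigenvector (pencil p r j) l (hy.toLp y)

/-- The functions `u₁, u₂` belong to `L₂(0,1)` and (the class of) `(u₁, u₂)` is an eigenfunction
of `D_j(P)`. -/
def IsDiracEigenfunction (P : ℝ → Matrix (Fin 2) (Fin 2) ℂ) (j : BC) (l : ℂ)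
    (u₁ u₂ : ℝ → ℂ) : Prop :=
  ∃ (h₁ : MemLp u₁ 2 vol01) (h₂ : MemLp u₂ 2 vol01),
    IsEigenvector (diracOp P j) l (WithLp.toLp 2 (h₁.toLp u₁, h₂.toLp u₂))

end EnergyPencil

end

namespace EnergyPencil

/-! ### Absolutely continuous functions -/

section AbsolutelyContinuous

/-! With the quasi-derivative as second unknown, the equation `T_j(l) y = G` is a 2×2 first order
system with integrable coefficients, and so is the Dirac equation, with `u₂` in the role of `y` and
`u₁` in that of the quasi-derivative. For such systems with the present boundary conditions the
Fredholm alternative holds (`exists_bvp_solution`): bounded invertibility means that the homogeneous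
boundary value problem has only the trivial solution. Both spectra thus reduce to statements about
homogeneous solutions.

For `l ≠ m` these solutions correspond through `u₁ = (y' - v y) / (l - m)`. Here `v = r + w/z`, with
`w` the quasi-derivative of `z`, and `w/z` is absolutely continuous and satisfies a Riccati
equation, which makes the substitution exact (`isSol_pencil_of_dirac`, `isSol_dirac_of_pencil`).
Since `w(1) = 0`, the boundary conditions correspond as well. At `l = m` the Wronskian with `z`
shows that neither pencil has a kernel, while the Dirac system becomes triangular: its kernel is
trivial for `j = 1` and contains `(1/z, 0)` for `j = 2`, whence the extra point.

All this needs `z > 0`, which is where negativity enters. Let `φ` be the solution vanishing at `0`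
with quasi-derivative `1` there. The Green function of `T_1(m)` is `-φ(min) z(max) / z(0)`;
negativity forces `z(0) φ z ≥ 0` on the diagonal (`green_diagonal_nonneg`). At an interior zero of
`z` the Wronskian gives `(z/φ)' = -z(0)/φ²`, so `z(0) φ z` would be negative just to the right
(`isMiuraSolution_pos`). -/

theorem ac_of_dist_le {X Y : Type*} [PseudoMetricSpace X] [PseudoMetricSpace Y] {f : ℝ → X}
    {g : ℝ → Y} {a b K : ℝ} (hg : AbsolutelyContinuousOnInterval g a b)
    (h : ∀ x ∈ uIcc a b, ∀ y ∈ uIcc a b, dist (f x) (f y) ≤ K * dist (g x) (g y)) :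
    AbsolutelyContinuousOnInterval f a b := by
  have hK := Tendsto.const_mul K hg
  rw [mul_zero] at hK
  refine squeeze_zero' (Eventually.of_forall fun t => Finset.sum_nonneg fun i _ => dist_nonneg)
    ?_ hK
  filter_upwards [mem_inf_of_right (mem_principal_self _)] with t ht
  rw [Finset.mul_sum]
  exact Finset.sum_le_sum fun i hi => h _ (ht.1 i hi).1 _ (ht.1 i hi).2

theorem ac_const {X : Type*} [PseudoMetricSpace X] (c : X) (a b : ℝ) :
    AbsolutelyContinuousOnInterval (fun _ : ℝ => c) a b :=
  ((LipschitzWith.const c).lipschitzOnWith (s := uIcc a b)).absolutelyContinuousOnInterval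

theorem ac_congr {X : Type*} [PseudoMetricSpace X] {f g : ℝ → X} {a b : ℝ}
    (hf : AbsolutelyContinuousOnInterval f a b) (h : EqOn g f (uIcc a b)) :
    AbsolutelyContinuousOnInterval g a b :=
  ac_of_dist_le (K := 1) hf fun x hx y hy => by rw [h hx, h hy, one_mul]

theorem ac_comp_lipschitz {X Y : Type*} [PseudoMetricSpace X] [PseudoMetricSpace Y]
    {f : ℝ → X} {g : X → Y} {a b : ℝ} {K : NNReal} {s : Set X}
    (hf : AbsolutelyContinuousOnInterval f a b) (hs : MapsTo f (uIcc a b) s)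
    (hg : LipschitzOnWith K g s) :
    AbsolutelyContinuousOnInterval (fun x => g (f x)) a b :=
  ac_of_dist_le hf fun _ hx _ hy => hg.dist_le_mul _ (hs hx) _ (hs hy)

theorem ac_prodMk {E F : Type*} [NormedAddCommGroup E] [NormedAddCommGroup F]
    {f : ℝ → E} {g : ℝ → F} {a b : ℝ}
    (hf : AbsolutelyContinuousOnInterval f a b) (hg : AbsolutelyContinuousOnInterval g a b) :
    AbsolutelyContinuousOnInterval (fun x => (f x, g x)) a b := by
  have h1 := ac_comp_lipschitz (g := fun x : E => (x, (0 : F))) hf (mapsTo_univ _ _)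
    (LipschitzWith.of_dist_le_mul (K := 1) fun x y => by simp [Prod.dist_eq]).lipschitzOnWith
  have h2 := ac_comp_lipschitz (g := fun x : F => ((0 : E), x)) hg (mapsTo_univ _ _)
    (LipschitzWith.of_dist_le_mul (K := 1) fun x y => by simp [Prod.dist_eq]).lipschitzOnWith
  exact ac_congr (h1.add h2) fun x _ => by simp

theorem ac_fst {E F : Type*} [NormedAddCommGroup E] [NormedAddCommGroup F]
    {f : ℝ → E × F} {a b : ℝ} (hf : AbsolutelyContinuousOnInterval f a b) :
    AbsolutelyContinuousOnInterval (fun x => (f x).1) a b :=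
  ac_comp_lipschitz hf (mapsTo_univ _ _) LipschitzWith.prod_fst.lipschitzOnWith

theorem ac_snd {E F : Type*} [NormedAddCommGroup E] [NormedAddCommGroup F]
    {f : ℝ → E × F} {a b : ℝ} (hf : AbsolutelyContinuousOnInterval f a b) :
    AbsolutelyContinuousOnInterval (fun x => (f x).2) a b :=
  ac_comp_lipschitz hf (mapsTo_univ _ _) LipschitzWith.prod_snd.lipschitzOnWith

theorem ac_ofReal {f : ℝ → ℝ} {a b : ℝ} (hf : AbsolutelyContinuousOnInterval f a b) :
    AbsolutelyContinuousOnInterval (fun x => (f x : ℂ)) a b :=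
  ac_of_dist_le (K := 1) hf fun x _ y _ => by
    rw [one_mul, Complex.dist_eq, Real.dist_eq, ← Complex.ofReal_sub, Complex.norm_real,
      Real.norm_eq_abs]

/-- A bound `C` for `1/f` on the compact interval makes inversion Lipschitz with constant `C²` on
the values of `f`. -/
theorem ac_inv {f : ℝ → ℝ} {a b : ℝ} (hf : AbsolutelyContinuousOnInterval f a b)
    (h0 : ∀ x ∈ uIcc a b, f x ≠ 0) : AbsolutelyContinuousOnInterval (fun x => (f x)⁻¹) a b := by
  obtain ⟨C, hC⟩ := isCompact_uIcc.exists_bound_of_continuousOn (hf.continuousOn.inv₀ h0)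
  refine ac_of_dist_le (K := C * C) hf fun x hx y hy => ?_
  have hx' := h0 x hx
  have hy' := h0 y hy
  have e : (f x)⁻¹ - (f y)⁻¹ = (f x)⁻¹ * (f y)⁻¹ * (f y - f x) := by field_simp
  rw [Real.dist_eq, Real.dist_eq, e, abs_mul, abs_mul, abs_sub_comm (f y)]
  exact mul_le_mul_of_nonneg_right (mul_le_mul (hC x hx) (hC y hy) (abs_nonneg _)
    ((norm_nonneg _).trans (hC x hx))) (abs_nonneg _)

theorem ae_uIcc_of_ae_Ioo {a b : ℝ} (hab : a ≤ b) {P : ℝ → Prop}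
    (h : ∀ᵐ x ∂volume.restrict (Ioo a b), P x) : ∀ᵐ x, x ∈ uIcc a b → P x := by
  rw [uIcc_of_le hab, ← ae_restrict_iff' measurableSet_Icc,
    ← Measure.restrict_congr_set Ioo_ae_eq_Icc]
  exact h

theorem ae_Ioo_of_ae_uIcc {a b : ℝ} (hab : a ≤ b) {P : ℝ → Prop}
    (h : ∀ᵐ x, x ∈ uIcc a b → P x) : ∀ᵐ x ∂volume.restrict (Ioo a b), P x := by
  rw [uIcc_of_le hab] at h
  rw [ae_restrict_iff' measurableSet_Ioo]
  filter_upwards [h] with x hx hx' using hx (Ioo_subset_Icc_self hx')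

theorem intervalIntegrable_of_integrable_Ioo {a b : ℝ} (hab : a ≤ b) {F : Type*}
    [NormedAddCommGroup F] {f : ℝ → F}
    (hf : Integrable f (volume.restrict (Ioo a b))) : IntervalIntegrable f volume a b := by
  rw [intervalIntegrable_iff_integrableOn_Ioc_of_le hab, IntegrableOn,
    ← Measure.restrict_congr_set Ioo_ae_eq_Ioc]
  exact hf

theorem intervalIntegrable_zero_left {F : Type*} [NormedAddCommGroup F] {g : ℝ → F}
    (hg : IntervalIntegrable g volume 0 1) {x : ℝ} (hx : x ∈ Icc (0 : ℝ) 1) :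
    IntervalIntegrable g volume 0 x := by
  refine hg.mono_set (uIcc_subset_uIcc left_mem_uIcc ?_)
  rwa [uIcc_of_le zero_le_one]

/-- Increments of the primitive of `f` are dominated by those of the primitive of `‖f‖`, which
reduces the vector-valued case to the real one. -/
theorem ac_integral {E : Type*} [NormedAddCommGroup E] [NormedSpace ℝ E]
    {f : ℝ → E} {a b : ℝ} (hf : IntervalIntegrable f volume a b) :
    AbsolutelyContinuousOnInterval (fun x => ∫ t in a..x, f t) a b := by
  have hn := hf.norm.absolutelyContinuousOnInterval_intervalIntegral (c := a) left_mem_uIcc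
  refine ac_of_dist_le (K := 1) hn fun x hx y hy => ?_
  have hsub : ∀ z ∈ uIcc a b, IntervalIntegrable f volume a z := fun z hz =>
    hf.mono_set (uIcc_subset_uIcc left_mem_uIcc hz)
  rw [one_mul, dist_eq_norm, dist_eq_norm, intervalIntegral.integral_interval_sub_left
    (hsub x hx) (hsub y hy), intervalIntegral.integral_interval_sub_left
    (hsub x hx).norm (hsub y hy).norm, Real.norm_eq_abs]
  exact intervalIntegral.norm_integral_le_abs_integral_norm

variable {E : Type*} [NormedAddCommGroup E] [NormedSpace ℝ E] [CompleteSpace E]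

theorem ae_hasDerivAt_integral {f : ℝ → E} {a b : ℝ} (hab : a ≤ b)
    (hf : IntervalIntegrable f volume a b) :
    ∀ᵐ x ∂volume.restrict (Ioo a b), HasDerivAt (fun x => ∫ t in a..x, f t) (f x) x := by
  refine ae_Ioo_of_ae_uIcc hab ?_
  filter_upwards [hf.ae_hasDerivAt_integral] with x hx hx' using hx hx' a left_mem_uIcc

/-- The fundamental theorem of calculus for absolutely continuous functions. -/
theorem eq_add_integral_of_ac {f f' : ℝ → E} {a b : ℝ} (hab : a ≤ b)
    (hf : AbsolutelyContinuousOnInterval f a b)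
    (hd : ∀ᵐ x ∂volume.restrict (Ioo a b), HasDerivAt f (f' x) x)
    (hf' : IntervalIntegrable f' volume a b) {x : ℝ} (hx : x ∈ Icc a b) :
    f x = f a + ∫ t in a..x, f' t := by
  have h0 : ∀ᵐ x, x ∈ uIcc a b →
      HasDerivAt (fun x => f x - ∫ t in a..x, f' t) 0 x := by
    refine ae_uIcc_of_ae_Ioo hab ?_
    filter_upwards [hd, ae_hasDerivAt_integral hab hf'] with x h1 h2
    exact (h1.sub h2).congr_deriv (sub_self _)
  obtain ⟨C, hC⟩ := (hf.sub (ac_integral hf')).const_of_ae_hasDerivAt_zero h0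
  rw [uIcc_of_le hab] at hC
  have h1 := hC x hx
  have h2 := hC a (left_mem_Icc.2 hab)
  simp only [Pi.sub_apply, intervalIntegral.integral_same, sub_zero] at h1 h2
  rw [h2, ← h1, sub_add_cancel]

theorem eqOn_const_of_ac {f : ℝ → E} {a b : ℝ} (hab : a ≤ b)
    (hf : AbsolutelyContinuousOnInterval f a b)
    (hd : ∀ᵐ x ∂volume.restrict (Ioo a b), HasDerivAt f 0 x) {x : ℝ} (hx : x ∈ Icc a b) :
    f x = f a := by
  simpa using eq_add_integral_of_ac hab hf hd intervalIntegrable_const hx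

end AbsolutelyContinuous

/-! ### Carathéodory differential equations with a Lipschitz right-hand side -/

section Caratheodory

/-- The primitive vanishing at `0`. -/
noncomputable def primitive (n : ℝ → ℝ) (x : ℝ) : ℝ := ∫ t in (0 : ℝ)..x, n t

theorem primitive_ac {n : ℝ → ℝ} (hn : Integrable n vol01) :
    AbsolutelyContinuousOnInterval (primitive n) 0 1 :=
  ac_integral (intervalIntegrable_of_integrable_Ioo zero_le_one hn)

theorem exp_primitive_ac {n : ℝ → ℝ} (hn : Integrable n vol01) (c : ℝ) :
    AbsolutelyContinuousOnInterval (fun x => Real.exp (c * primitive n x)) 0 1 := by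
  obtain ⟨C, hC⟩ := (primitive_ac hn).exists_bound
  have hexp : ContDiff ℝ 1 (fun x : ℝ => Real.exp (c * x)) := by fun_prop
  obtain ⟨K, hK⟩ := hexp.contDiffOn.exists_lipschitzOnWith (s := Icc (-C) C) one_ne_zero
    (convex_Icc _ _) isCompact_Icc
  exact ac_comp_lipschitz (primitive_ac hn) (g := fun x : ℝ => Real.exp (c * x))
    (s := Icc (-C) C) (fun x hx => abs_le.1 (hC x hx)) hK

/-- The integrand is half the derivative of `exp (2 * primitive n)`. This factor one half is the
contraction constant below, and it lets Gronwall's inequality absorb the integral term. -/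
theorem integral_exp_primitive {n : ℝ → ℝ} (hn : Integrable n vol01) {x : ℝ}
    (hx : x ∈ Icc (0 : ℝ) 1) :
    ∫ t in (0 : ℝ)..x, n t * Real.exp (2 * primitive n t) =
      (Real.exp (2 * primitive n x) - 1) / 2 := by
  have hI := intervalIntegrable_of_integrable_Ioo zero_le_one hn
  have h1 : IntervalIntegrable (fun t => 2 * (n t * Real.exp (2 * primitive n t))) volume 0 1 :=
    (hI.mul_continuousOn (exp_primitive_ac hn 2).continuousOn).const_mul 2
  have h2 : ∀ᵐ x ∂vol01, HasDerivAt (fun x => Real.exp (2 * primitive n x))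
      (2 * (n x * Real.exp (2 * primitive n x))) x := by
    filter_upwards [ae_hasDerivAt_integral zero_le_one hI] with x hx
    refine ((hx.const_mul 2).exp).congr_deriv ?_
    simp only [primitive]; ring
  have := eq_add_integral_of_ac zero_le_one (exp_primitive_ac hn 2) h2 h1 hx
  rw [intervalIntegral.integral_const_mul] at this
  have e0 : primitive n 0 = 0 := intervalIntegral.integral_same
  rw [e0, mul_zero, Real.exp_zero] at this
  linarith

theorem primitive_le_one {n : ℝ → ℝ} (hn : Integrable n vol01) (h0 : ∀ x, 0 ≤ n x) {x : ℝ}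
    (hx : x ∈ Icc (0 : ℝ) 1) : primitive n x ≤ primitive n 1 := by
  have hI := intervalIntegrable_of_integrable_Ioo zero_le_one hn
  exact intervalIntegral.integral_mono_interval le_rfl hx.1 hx.2
    (Eventually.of_forall h0) hI

theorem primitive_nonneg {n : ℝ → ℝ} (h0 : ∀ x, 0 ≤ n x) {x : ℝ} (hx : 0 ≤ x) :
    0 ≤ primitive n x := intervalIntegral.integral_nonneg hx fun t _ => h0 t

/-- A Gronwall inequality with an integrable coefficient. -/
theorem gronwall_integrable {n : ℝ → ℝ} (hn : Integrable n vol01) (h0 : ∀ x, 0 ≤ n x)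
    {E : Type*} [NormedAddCommGroup E] {Y : ℝ → E} (hY : ContinuousOn Y (Icc 0 1)) {D : ℝ}
    (h : ∀ x ∈ Icc (0 : ℝ) 1, ‖Y x‖ ≤ D + ∫ t in (0 : ℝ)..x, n t * ‖Y t‖) :
    ∀ x ∈ Icc (0 : ℝ) 1, ‖Y x‖ ≤ 2 * Real.exp (2 * primitive n 1) * D := by
  have hI := intervalIntegrable_of_integrable_Ioo zero_le_one hn
  have hE := (exp_primitive_ac hn 2).continuousOn
  have hE' := (exp_primitive_ac hn (-2)).continuousOn
  rw [uIcc_of_le zero_le_one] at hE'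
  -- The weighted norm `exp (-2 * primitive n x) * ‖Y x‖` is maximised at `c`, with maximum `s`.
  obtain ⟨c, hc, hmax⟩ := isCompact_Icc.exists_isMaxOn ⟨0, left_mem_Icc.2 zero_le_one⟩
    (hE'.mul hY.norm)
  set s : ℝ := Real.exp (-2 * primitive n c) * ‖Y c‖ with hs
  have hs0 : 0 ≤ s := by positivity
  have hYs : ∀ x ∈ Icc (0 : ℝ) 1, ‖Y x‖ ≤ s * Real.exp (2 * primitive n x) := by
    intro x hx
    have h1 : Real.exp (-2 * primitive n x) * ‖Y x‖ ≤ s := hmax hx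
    have h2 := mul_le_mul_of_nonneg_right h1 (Real.exp_pos (2 * primitive n x)).le
    rwa [mul_right_comm, ← Real.exp_add, show -2 * primitive n x + 2 * primitive n x = 0 by ring,
      Real.exp_zero, one_mul] at h2
  have hnY : IntervalIntegrable (fun t => n t * ‖Y t‖) volume 0 1 :=
    hI.mul_continuousOn (by rw [uIcc_of_le zero_le_one]; exact hY.norm)
  have key : ∀ x ∈ Icc (0 : ℝ) 1,
      ‖Y x‖ ≤ D + s * ((Real.exp (2 * primitive n x) - 1) / 2) := by
    intro x hx
    refine (h x hx).trans (add_le_add_right ?_ D)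
    rw [← integral_exp_primitive hn hx, ← intervalIntegral.integral_const_mul]
    refine intervalIntegral.integral_mono_on hx.1 (intervalIntegrable_zero_left hnY hx)
      (intervalIntegrable_zero_left ((hI.mul_continuousOn hE).const_mul s) hx) fun t ht => ?_
    calc n t * ‖Y t‖ ≤ n t * (s * Real.exp (2 * primitive n t)) :=
          mul_le_mul_of_nonneg_left (hYs t ⟨ht.1, ht.2.trans hx.2⟩) (h0 t)
      _ = _ := by ring
  -- Evaluating `key` at the maximum point `c` gives `s ≤ D + s / 2`.
  have hsD : s ≤ 2 * D := by
    have hD : 0 ≤ D := by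
      have := (norm_nonneg _).trans (h 0 (left_mem_Icc.2 zero_le_one))
      simpa using this
    have h1 := mul_le_mul_of_nonneg_left (key c hc) (Real.exp_pos (-2 * primitive n c)).le
    have e : Real.exp (-2 * primitive n c) * Real.exp (2 * primitive n c) = 1 := by
      rw [← Real.exp_add, show -2 * primitive n c + 2 * primitive n c = 0 by ring, Real.exp_zero]
    have hle : Real.exp (-2 * primitive n c) ≤ 1 :=
      Real.exp_le_one_iff.2 (by have := primitive_nonneg h0 hc.1; linarith)
    have e2 : Real.exp (-2 * primitive n c) * (D + s * ((Real.exp (2 * primitive n c) - 1) / 2)) =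
        Real.exp (-2 * primitive n c) * D + s / 2 - Real.exp (-2 * primitive n c) * s / 2 := by
      linear_combination (s / 2) * e
    rw [e2, ← hs] at h1
    have h3 : 0 ≤ Real.exp (-2 * primitive n c) * s := by positivity
    have h4 := mul_le_mul_of_nonneg_right hle hD
    linarith
  intro x hx
  have hD : 0 ≤ D := by linarith
  calc ‖Y x‖ ≤ s * Real.exp (2 * primitive n x) := hYs x hx
    _ ≤ (2 * D) * Real.exp (2 * primitive n 1) := by
        refine mul_le_mul hsD (Real.exp_le_exp.2 ?_) (Real.exp_pos _).le (by linarith)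
        have := primitive_le_one hn h0 hx
        linarith
    _ = _ := by ring

/-- Existence for the Carathéodory Cauchy problem `Y' = f(x, Y)`, `Y(0) = Y₀` on `[0,1]`. -/
theorem exists_caratheodory {E : Type*} [NormedAddCommGroup E] [NormedSpace ℝ E]
    [CompleteSpace E] {n : ℝ → ℝ} (hn : Integrable n vol01) (h0 : ∀ x, 0 ≤ n x)
    {f : ℝ → E → E} (hf : ∀ Z : ℝ → E, ContinuousOn Z (Icc 0 1) →
      Integrable (fun x => f x (Z x)) vol01)
    (hlip : ∀ x Y Y', ‖f x Y - f x Y'‖ ≤ n x * ‖Y - Y'‖) (Y₀ : E) :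
    ∃ Y : ℝ → E, AbsolutelyContinuousOnInterval Y 0 1 ∧ Y 0 = Y₀ ∧
      ∀ᵐ x ∂vol01, HasDerivAt Y (f x (Y x)) x := by
  have hI := intervalIntegrable_of_integrable_Ioo zero_le_one hn
  have hE := (exp_primitive_ac hn 2).continuousOn
  have hE' := (exp_primitive_ac hn (-2)).continuousOn
  rw [uIcc_of_le zero_le_one] at hE hE'
  -- Picard iteration for the rescaled unknown `Z = exp (-2 * primitive n) • Y`: `U` undoes the
  -- scaling, `V` is the integral operator. In the scaled variable the iteration contracts by `1/2`
  -- on the whole interval at once.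
  let X := C(Icc (0 : ℝ) 1, E)
  let U : X → ℝ → E := fun Z x => Real.exp (2 * primitive n x) • IccExtend zero_le_one Z x
  have hU : ∀ Z, ContinuousOn (U Z) (Icc 0 1) := fun Z =>
    hE.smul (Z.continuous.Icc_extend' (h := zero_le_one)).continuousOn
  have hUf : ∀ Z, IntervalIntegrable (fun t => f t (U Z t)) volume 0 1 := fun Z =>
    intervalIntegrable_of_integrable_Ioo zero_le_one (hf _ (hU Z))
  let V : X → ℝ → E := fun Z x => Y₀ + ∫ t in (0 : ℝ)..x, f t (U Z t)
  have hVac : ∀ Z, AbsolutelyContinuousOnInterval (V Z) 0 1 := fun Z =>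
    (ac_const Y₀ 0 1).add (ac_integral (hUf Z))
  have hV : ∀ Z, ContinuousOn (V Z) (Icc 0 1) := fun Z => by
    have := (hVac Z).continuousOn
    rwa [uIcc_of_le zero_le_one] at this
  let Φ : X → X := fun Z =>
    ⟨fun x => Real.exp (-2 * primitive n x) • V Z x,
      (hE'.smul (hV Z)).domRestrict⟩
  have hΦ : ContractingWith (1 / 2) Φ := by
    refine ⟨by rw [← NNReal.coe_lt_coe]; norm_num, LipschitzWith.of_dist_le_mul fun Z Z' => ?_⟩
    rw [ContinuousMap.dist_le (by positivity)]
    rintro ⟨x, hx⟩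
    have hVV : ‖V Z x - V Z' x‖ ≤ dist Z Z' * ((Real.exp (2 * primitive n x) - 1) / 2) := by
      have e : V Z x - V Z' x = ∫ t in (0 : ℝ)..x, (f t (U Z t) - f t (U Z' t)) := by
        simp only [V]
        rw [intervalIntegral.integral_sub (intervalIntegrable_zero_left (hUf Z) hx) (intervalIntegrable_zero_left (hUf Z') hx)]
        abel
      rw [e, ← integral_exp_primitive hn hx, ← intervalIntegral.integral_const_mul]
      refine intervalIntegral.norm_integral_le_of_norm_le hx.1 (Eventually.of_forall fun t ht => ?_)
        (intervalIntegrable_zero_left ((hI.mul_continuousOn (exp_primitive_ac hn 2).continuousOn).const_mul _) hx)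
      refine (hlip _ _ _).trans ?_
      have : ‖U Z t - U Z' t‖ ≤ Real.exp (2 * primitive n t) * dist Z Z' := by
        simp only [U]
        rw [← smul_sub, norm_smul, Real.norm_eq_abs, abs_of_pos (Real.exp_pos _), ← dist_eq_norm]
        exact mul_le_mul_of_nonneg_left (ContinuousMap.dist_apply_le_dist _) (Real.exp_pos _).le
      calc n t * ‖U Z t - U Z' t‖ ≤ n t * (Real.exp (2 * primitive n t) * dist Z Z') :=
            mul_le_mul_of_nonneg_left this (h0 t)
        _ = _ := by ring
    change dist (Real.exp (-2 * primitive n x) • V Z x) (Real.exp (-2 * primitive n x) • V Z' x) ≤ _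
    rw [dist_eq_norm, ← smul_sub, norm_smul, Real.norm_eq_abs, abs_of_pos (Real.exp_pos _)]
    have e : Real.exp (-2 * primitive n x) * Real.exp (2 * primitive n x) = 1 := by
      rw [← Real.exp_add, show -2 * primitive n x + 2 * primitive n x = 0 by ring, Real.exp_zero]
    have h1 := mul_le_mul_of_nonneg_left hVV (Real.exp_pos (-2 * primitive n x)).le
    have h2 : 0 ≤ Real.exp (-2 * primitive n x) * dist Z Z' := by positivity
    have e2 : Real.exp (-2 * primitive n x) *
        (dist Z Z' * ((Real.exp (2 * primitive n x) - 1) / 2)) =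
        dist Z Z' / 2 - Real.exp (-2 * primitive n x) * dist Z Z' / 2 := by
      linear_combination (dist Z Z' / 2) * e
    rw [e2] at h1
    have e3 : ((1 / 2 : NNReal) : ℝ) = 1 / 2 := by norm_num
    rw [e3]
    linarith
  let Z := ContractingWith.fixedPoint Φ hΦ
  have hZ : Φ Z = Z := ContractingWith.fixedPoint_isFixedPt hΦ
  have hUV : EqOn (U Z) (V Z) (Icc 0 1) := by
    intro x hx
    have h1 : Real.exp (-2 * primitive n x) • V Z x = Z ⟨x, hx⟩ :=
      congrArg (fun T : X => T ⟨x, hx⟩) hZ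
    simp only [U]
    rw [IccExtend_of_mem _ _ hx, ← h1, smul_smul, ← Real.exp_add,
      show 2 * primitive n x + -2 * primitive n x = 0 by ring, Real.exp_zero, one_smul]
  refine ⟨V Z, hVac Z, by simp [V], ?_⟩
  filter_upwards [ae_hasDerivAt_integral zero_le_one (hUf Z), ae_restrict_mem measurableSet_Ioo]
    with x hx hm
  rw [← hUV (Ioo_subset_Icc_self hm)]
  exact hx.const_add Y₀

end Caratheodory

/-! ### First order systems of size two -/

section Systems

variable {𝕜 : Type*} [RCLike 𝕜]

/-- `(y, w)` is an absolutely continuous solution of `y' = a y + b w + F`, `w' = c y + d w + G`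
on `[0,1]`. -/
structure IsSol (a b c d F G y w : ℝ → 𝕜) : Prop where
  ac_y : AbsolutelyContinuousOnInterval y 0 1
  ac_w : AbsolutelyContinuousOnInterval w 0 1
  deriv_y : ∀ᵐ x ∂vol01, HasDerivAt y (a x * y x + b x * w x + F x) x
  deriv_w : ∀ᵐ x ∂vol01, HasDerivAt w (c x * y x + d x * w x + G x) x

variable {a b c d F G F' G' y w y' w' : ℝ → 𝕜}

theorem IsSol.add_const_mul (h : IsSol a b c d F G y w) (h' : IsSol a b c d F' G' y' w') (s : 𝕜) :
    IsSol a b c d (fun x => F x + s * F' x) (fun x => G x + s * G' x)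
      (fun x => y x + s * y' x) (fun x => w x + s * w' x) := by
  refine ⟨h.ac_y.add (h'.ac_y.const_smul s), h.ac_w.add (h'.ac_w.const_smul s), ?_, ?_⟩
  · filter_upwards [h.deriv_y, h'.deriv_y] with x h1 h2
    exact (h1.add (h2.const_mul s)).congr_deriv (by ring)
  · filter_upwards [h.deriv_w, h'.deriv_w] with x h1 h2
    exact (h1.add (h2.const_mul s)).congr_deriv (by ring)

theorem IsSol.congr_ae (h : IsSol a b c d F G y w) {a' b' c' d' : ℝ → 𝕜}
    (hy : ∀ᵐ x ∂vol01, a x * y x + b x * w x + F x = a' x * y x + b' x * w x + F' x)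
    (hw : ∀ᵐ x ∂vol01, c x * y x + d x * w x + G x = c' x * y x + d' x * w x + G' x) :
    IsSol a' b' c' d' F' G' y w := by
  refine ⟨h.ac_y, h.ac_w, ?_, ?_⟩
  · filter_upwards [h.deriv_y, hy] with x h1 h2 using h1.congr_deriv h2
  · filter_upwards [h.deriv_w, hw] with x h1 h2 using h1.congr_deriv h2

theorem integrable_mul_continuousOn {u v : ℝ → 𝕜} (hu : Integrable u vol01)
    (hv : ContinuousOn v (Icc 0 1)) : Integrable (fun x => u x * v x) vol01 := by
  have h1 : IntervalIntegrable (fun x => u x * v x) volume 0 1 :=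
    (intervalIntegrable_of_integrable_Ioo zero_le_one hu).mul_continuousOn
      (by rwa [uIcc_of_le zero_le_one])
  rw [intervalIntegrable_iff_integrableOn_Ioo_of_le zero_le_one] at h1
  exact h1

theorem norm_system_le (a b c d : 𝕜) (Y : 𝕜 × 𝕜) :
    ‖(a * Y.1 + b * Y.2, c * Y.1 + d * Y.2)‖ ≤ (‖a‖ + ‖b‖ + ‖c‖ + ‖d‖) * ‖Y‖ := by
  have key : ∀ s t : 𝕜, ‖s * Y.1 + t * Y.2‖ ≤ (‖s‖ + ‖t‖) * ‖Y‖ := fun s t => by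
    refine (norm_add_le _ _).trans ?_
    rw [norm_mul, norm_mul, add_mul]
    exact add_le_add (mul_le_mul_of_nonneg_left (norm_fst_le Y) (norm_nonneg _))
      (mul_le_mul_of_nonneg_left (norm_snd_le Y) (norm_nonneg _))
  have := norm_nonneg a; have := norm_nonneg b; have := norm_nonneg c; have := norm_nonneg d
  refine norm_prod_le_iff.2 ⟨(key a b).trans ?_, (key c d).trans ?_⟩ <;>
    exact mul_le_mul_of_nonneg_right (by linarith) (norm_nonneg _)

theorem exists_isSol (ha : Integrable a vol01) (hb : Integrable b vol01)
    (hc : Integrable c vol01) (hd : Integrable d vol01) (hF : Integrable F vol01)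
    (hG : Integrable G vol01) (y₀ w₀ : 𝕜) :
    ∃ y w, IsSol a b c d F G y w ∧ y 0 = y₀ ∧ w 0 = w₀ := by
  let f : ℝ → 𝕜 × 𝕜 → 𝕜 × 𝕜 :=
    fun x Z => (a x * Z.1 + b x * Z.2 + F x, c x * Z.1 + d x * Z.2 + G x)
  have hf : ∀ Z : ℝ → 𝕜 × 𝕜, ContinuousOn Z (Icc 0 1) →
      Integrable (fun x => f x (Z x)) vol01 := fun Z hZ =>
    (((integrable_mul_continuousOn ha hZ.fst).add
      (integrable_mul_continuousOn hb hZ.snd)).add hF).prodMk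
      (((integrable_mul_continuousOn hc hZ.fst).add
      (integrable_mul_continuousOn hd hZ.snd)).add hG)
  have hlip : ∀ x Y Y', ‖f x Y - f x Y'‖ ≤ (‖a x‖ + ‖b x‖ + ‖c x‖ + ‖d x‖) * ‖Y - Y'‖ := by
    intro x Y Y'
    refine le_trans (le_of_eq ?_) (norm_system_le (a x) (b x) (c x) (d x) (Y - Y'))
    congr 1
    ext <;> simp [f] <;> ring
  have hn : ∀ x, 0 ≤ ‖a x‖ + ‖b x‖ + ‖c x‖ + ‖d x‖ := fun x => by positivity
  obtain ⟨Y, hY, hY0, hY'⟩ := exists_caratheodory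
    (((ha.norm.add hb.norm).add hc.norm).add hd.norm) hn hf hlip (y₀, w₀)
  refine ⟨fun x => (Y x).1, fun x => (Y x).2, ⟨ac_fst hY, ac_snd hY, ?_, ?_⟩,
    congrArg Prod.fst hY0, congrArg Prod.snd hY0⟩
  · filter_upwards [hY'] with x hx using hx.fst
  · filter_upwards [hY'] with x hx using hx.snd

/-- Continuous dependence of the solution on the data. -/
theorem exists_isSol_bound (ha : Integrable a vol01) (hb : Integrable b vol01)
    (hc : Integrable c vol01) (hd : Integrable d vol01) :
    ∃ C : ℝ, 0 ≤ C ∧ ∀ F G y w : ℝ → 𝕜, Integrable F vol01 → Integrable G vol01 →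
      IsSol a b c d F G y w → ∀ x ∈ Icc (0 : ℝ) 1,
        ‖y x‖ ≤ C * (‖y 0‖ + ‖w 0‖ + (∫ t, ‖F t‖ ∂vol01) + ∫ t, ‖G t‖ ∂vol01) ∧
        ‖w x‖ ≤ C * (‖y 0‖ + ‖w 0‖ + (∫ t, ‖F t‖ ∂vol01) + ∫ t, ‖G t‖ ∂vol01) := by
  set n : ℝ → ℝ := fun x => ‖a x‖ + ‖b x‖ + ‖c x‖ + ‖d x‖ with hn_def
  have hn : Integrable n vol01 := ((ha.norm.add hb.norm).add hc.norm).add hd.norm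
  have hn0 : ∀ x, 0 ≤ n x := fun x => by positivity
  refine ⟨2 * Real.exp (2 * primitive n 1), by positivity, fun F G y w hF hG h x hx => ?_⟩
  have hY := ac_prodMk h.ac_y h.ac_w
  have hYc := hY.continuousOn
  have hyc := h.ac_y.continuousOn
  have hwc := h.ac_w.continuousOn
  rw [uIcc_of_le zero_le_one] at hYc hyc hwc
  have hI : Integrable (fun x => (a x * y x + b x * w x + F x, c x * y x + d x * w x + G x))
      vol01 :=
    (((integrable_mul_continuousOn ha hyc).add (integrable_mul_continuousOn hb hwc)).add hF).prodMk
      (((integrable_mul_continuousOn hc hyc).add (integrable_mul_continuousOn hd hwc)).add hG)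
  have hnY : IntervalIntegrable (fun t => n t * ‖(y t, w t)‖) volume 0 1 :=
    intervalIntegrable_of_integrable_Ioo zero_le_one (integrable_mul_continuousOn hn hYc.norm)
  have hFG : IntervalIntegrable (fun t => ‖F t‖ + ‖G t‖) volume 0 1 :=
    intervalIntegrable_of_integrable_Ioo zero_le_one (hF.norm.add hG.norm)
  have hg := gronwall_integrable hn hn0 hYc
    (D := ‖y 0‖ + ‖w 0‖ + (∫ t, ‖F t‖ ∂vol01) + ∫ t, ‖G t‖ ∂vol01) ?_ x hx
  · exact ⟨(norm_fst_le (y x, w x)).trans hg, (norm_snd_le (y x, w x)).trans hg⟩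
  intro x hx
  have hd : ∀ᵐ x ∂vol01, HasDerivAt (fun x => (y x, w x))
      (a x * y x + b x * w x + F x, c x * y x + d x * w x + G x) x := by
    filter_upwards [h.deriv_y, h.deriv_w] with x h1 h2 using h1.prodMk h2
  rw [eq_add_integral_of_ac zero_le_one hY hd
    (intervalIntegrable_of_integrable_Ioo zero_le_one hI) hx]
  refine (norm_add_le _ _).trans ?_
  have h1 : ‖(y 0, w 0)‖ ≤ ‖y 0‖ + ‖w 0‖ :=
    norm_prod_le_iff.2 ⟨by simp, by simp⟩
  have h2 : ‖∫ t in (0 : ℝ)..x, (a t * y t + b t * w t + F t, c t * y t + d t * w t + G t)‖ ≤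
      ∫ t in (0 : ℝ)..x, (n t * ‖(y t, w t)‖ + (‖F t‖ + ‖G t‖)) := by
    refine intervalIntegral.norm_integral_le_of_norm_le hx.1 (Eventually.of_forall fun t _ => ?_)
      (intervalIntegrable_zero_left (hnY.add hFG) hx)
    have e : ((a t * y t + b t * w t + F t, c t * y t + d t * w t + G t) : 𝕜 × 𝕜) =
        (a t * y t + b t * w t, c t * y t + d t * w t) + (F t, G t) := rfl
    rw [e]
    refine (norm_add_le _ _).trans (add_le_add (norm_system_le _ _ _ _ (y t, w t)) ?_)
    exact norm_prod_le_iff.2 ⟨by simp, by simp⟩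
  rw [intervalIntegral.integral_add (intervalIntegrable_zero_left hnY hx)
    (intervalIntegrable_zero_left hFG hx)] at h2
  -- The forcing is integrated over the whole interval, so that the Gronwall constant does not
  -- depend on `x`.
  have h3 : ∫ t in (0 : ℝ)..x, (‖F t‖ + ‖G t‖) ≤ ∫ t in (0 : ℝ)..1, (‖F t‖ + ‖G t‖) :=
    intervalIntegral.integral_mono_interval le_rfl hx.1 hx.2
      (Eventually.of_forall fun t => by positivity) hFG
  have h4 : ∫ t in (0 : ℝ)..1, (‖F t‖ + ‖G t‖) =
      (∫ t, ‖F t‖ ∂vol01) + ∫ t, ‖G t‖ ∂vol01 := by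
    rw [intervalIntegral.integral_of_le zero_le_one, integral_Ioc_eq_integral_Ioo,
      integral_add hF.norm hG.norm]
  linarith

/-- Solutions of homogeneous systems are determined by their initial values. -/
theorem IsSol.eq_zero (ha : Integrable a vol01) (hb : Integrable b vol01)
    (hc : Integrable c vol01) (hd : Integrable d vol01) (h : IsSol a b c d 0 0 y w)
    (hy : y 0 = 0) (hw : w 0 = 0) : ∀ x ∈ Icc (0 : ℝ) 1, y x = 0 ∧ w x = 0 := by
  obtain ⟨C, -, hC⟩ := exists_isSol_bound ha hb hc hd
  intro x hx
  have := hC 0 0 y w (integrable_zero _ _ _) (integrable_zero _ _ _) h x hx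
  simpa [hy, hw] using this

/-- The Wronskian of two solutions of a homogeneous system with trace zero is constant. -/
theorem IsSol.wronskian (h : IsSol a b c (-a) 0 0 y w) (h' : IsSol a b c (-a) 0 0 y' w') :
    ∀ x ∈ Icc (0 : ℝ) 1, y x * w' x - w x * y' x = y 0 * w' 0 - w 0 * y' 0 := by
  intro x hx
  refine eqOn_const_of_ac (f := fun x => y x * w' x - w x * y' x) zero_le_one
    ((h.ac_y.fun_smul h'.ac_w).fun_sub (h.ac_w.fun_smul h'.ac_y)) ?_ hx
  filter_upwards [h.deriv_y, h.deriv_w, h'.deriv_y, h'.deriv_w] with x h1 h2 h3 h4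
  refine ((h1.mul h4).sub (h2.mul h3)).congr_deriv ?_
  simp only [Pi.zero_apply, Pi.neg_apply]
  ring

end Systems

/-- If the homogeneous boundary value problem has only the trivial solution, then the
inhomogeneous one is solvable, with an a priori bound. -/
theorem exists_bvp_solution {a b c d : ℝ → ℂ} (ha : Integrable a vol01) (hb : Integrable b vol01)
    (hc : Integrable c vol01) (hd : Integrable d vol01) (j : BC)
    (huniq : ∀ y w, IsSol a b c d 0 0 y w → y 0 = 0 → j.pick (w 1) (y 1) = 0 → w 0 = 0) :
    ∃ C : ℝ, 0 ≤ C ∧ ∀ F G : ℝ → ℂ, Integrable F vol01 → Integrable G vol01 →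
      ∃ y w, IsSol a b c d F G y w ∧ y 0 = 0 ∧ j.pick (w 1) (y 1) = 0 ∧
        ∀ x ∈ Icc (0 : ℝ) 1, ‖y x‖ ≤ C * ((∫ t, ‖F t‖ ∂vol01) + ∫ t, ‖G t‖ ∂vol01) ∧
          ‖w x‖ ≤ C * ((∫ t, ‖F t‖ ∂vol01) + ∫ t, ‖G t‖ ∂vol01) := by
  obtain ⟨C, hC0, hC⟩ := exists_isSol_bound ha hb hc hd
  -- `(φ, ψ)` spans the homogeneous solutions satisfying the condition at `0`; its boundary value
  -- `k` at `1` is the characteristic function, nonzero by uniqueness.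
  obtain ⟨φ, ψ, hφ, hφ0, hψ0⟩ := exists_isSol (F := 0) (G := 0) ha hb hc hd
    (integrable_zero _ _ _) (integrable_zero _ _ _) 0 1
  set k := j.pick (ψ 1) (φ 1) with hk_def
  have hk : k ≠ 0 := fun h0 => by simpa [hψ0] using huniq φ ψ hφ hφ0 h0
  have hone : (1 : ℝ) ∈ Icc (0 : ℝ) 1 := right_mem_Icc.2 zero_le_one
  -- The particular solution with zero initial data contributes `C`. The corrector `s φ` contributes
  -- `‖k‖⁻¹ * C` through `s` and another `C` through the bound for `(φ, ψ)`.
  refine ⟨C + ‖k‖⁻¹ * C * C, by positivity, fun F G hF hG => ?_⟩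
  obtain ⟨y, w, h, hy0, hw0⟩ := exists_isSol ha hb hc hd hF hG 0 0
  have hb := hC F G y w hF hG h
  have hφb := hC 0 0 φ ψ (integrable_zero _ _ _) (integrable_zero _ _ _) hφ
  simp only [hy0, hw0, norm_zero, zero_add] at hb
  simp only [hφ0, hψ0, norm_zero, norm_one, Pi.zero_apply, integral_zero, zero_add, add_zero,
    mul_one] at hφb
  set D := (∫ t, ‖F t‖ ∂vol01) + ∫ t, ‖G t‖ ∂vol01
  have hD : 0 ≤ D := by positivity
  set s : ℂ := -(j.pick (w 1) (y 1)) / k with hs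
  have hsn : ‖s‖ ≤ ‖k‖⁻¹ * (C * D) := by
    rw [hs, norm_div, norm_neg, div_eq_inv_mul]
    refine mul_le_mul_of_nonneg_left ?_ (by positivity)
    cases j
    exacts [(hb 1 hone).2, (hb 1 hone).1]
  refine ⟨_, _, (h.add_const_mul hφ s).congr_ae (F' := F) (G' := G) ?_ ?_, ?_, ?_,
    fun x hx => ?_⟩
  · exact Eventually.of_forall fun x => by simp
  · exact Eventually.of_forall fun x => by simp
  · simp [hy0, hφ0]
  · have e : j.pick (w 1 + s * ψ 1) (y 1 + s * φ 1) = j.pick (w 1) (y 1) + s * k := by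
      cases j <;> rfl
    rw [e, hs, div_mul_cancel₀ _ hk, add_neg_cancel]
  · have key : ∀ u v : ℂ, ‖u‖ ≤ C * D → ‖v‖ ≤ C → ‖u + s * v‖ ≤ (C + ‖k‖⁻¹ * C * C) * D := by
      intro u v hu hv
      refine (norm_add_le _ _).trans ?_
      rw [norm_mul]
      have := mul_le_mul hsn hv (norm_nonneg _) (by positivity)
      linarith
    exact ⟨key _ _ (hb x hx).1 (hφb x hx).1, key _ _ (hb x hx).2 (hφb x hx).2⟩

/-! ### Graphs and bounded inverses of partial linear maps -/

section Operators

variable {E : Type*} [NormedAddCommGroup E] [NormedSpace ℂ E]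

/-- Operators are handled through their graphs from here on: intersections of domains become
existential witnesses. -/
theorem mem_sub_graph {T S : E →ₗ.[ℂ] E} {x z : E} :
    (x, z) ∈ (T - S).graph ↔ ∃ a b, (x, a) ∈ T.graph ∧ (x, b) ∈ S.graph ∧ z = a - b := by
  constructor
  · intro h
    obtain ⟨⟨y, hy⟩, rfl, rfl⟩ := (LinearPMap.mem_graph_iff _).1 h
    exact ⟨T ⟨y, hy.1⟩, S ⟨y, hy.2⟩, T.mem_graph ⟨y, hy.1⟩, S.mem_graph ⟨y, hy.2⟩,
      LinearPMap.sub_apply _ _ _⟩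
  · rintro ⟨a, b, ha, hb, rfl⟩
    obtain ⟨⟨y, hy⟩, rfl, rfl⟩ := (LinearPMap.mem_graph_iff _).1 ha
    obtain ⟨⟨y', hy'⟩, h, rfl⟩ := (LinearPMap.mem_graph_iff _).1 hb
    obtain rfl : y' = y := h
    exact (LinearPMap.mem_graph_iff _).2 ⟨⟨y', hy, hy'⟩, rfl, LinearPMap.sub_apply _ _ _⟩

theorem mem_smul_graph {T : E →ₗ.[ℂ] E} {l : ℂ} {x z : E} :
    (x, z) ∈ (l • T).graph ↔ ∃ a, (x, a) ∈ T.graph ∧ z = l • a := by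
  constructor
  · intro h
    obtain ⟨⟨y, hy⟩, rfl, rfl⟩ := (LinearPMap.mem_graph_iff _).1 h
    exact ⟨T ⟨y, hy⟩, T.mem_graph ⟨y, hy⟩, LinearPMap.smul_apply _ _ _⟩
  · rintro ⟨a, ha, rfl⟩
    obtain ⟨⟨y, hy⟩, rfl, rfl⟩ := (LinearPMap.mem_graph_iff _).1 ha
    exact (LinearPMap.mem_graph_iff _).2 ⟨⟨y, hy⟩, rfl, LinearPMap.smul_apply _ _ _⟩

theorem mem_idOp_graph {x z : E} : (x, z) ∈ (idOp E).graph ↔ z = x := by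
  constructor
  · intro h
    obtain ⟨⟨y, hy⟩, rfl, rfl⟩ := (LinearPMap.mem_graph_iff _).1 h
    rfl
  · rintro rfl
    exact (LinearPMap.mem_graph_iff _).2 ⟨⟨z, trivial⟩, rfl, rfl⟩

theorem mem_sub_smul_idOp_graph {T : E →ₗ.[ℂ] E} {l : ℂ} {x z : E} :
    (x, z) ∈ (T - l • idOp E).graph ↔ (x, z + l • x) ∈ T.graph := by
  simp only [mem_sub_graph, mem_smul_graph, mem_idOp_graph]
  constructor
  · rintro ⟨a, b, ha, ⟨c, rfl, rfl⟩, rfl⟩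
    simpa using ha
  · intro h
    exact ⟨_, _, h, ⟨x, rfl, rfl⟩, by simp⟩

theorem BoundedlyInvertible.eq_zero {T : E →ₗ.[ℂ] E} (hT : BoundedlyInvertible T) {y : E}
    (hy : (y, (0 : E)) ∈ T.graph) : y = 0 := by
  obtain ⟨S, -, hS⟩ := hT
  obtain ⟨y, rfl, h0⟩ := (LinearPMap.mem_graph_iff _).1 hy
  rw [← hS y, h0]
  exact map_zero S

/-- Injectivity makes the chosen preimages unique, hence linear in `f`; no closedness of `T` is
needed. -/
theorem boundedlyInvertible_of_bound {T : E →ₗ.[ℂ] E} {C : ℝ}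
    (h : ∀ f : E, ∃ y, (y, f) ∈ T.graph ∧ ‖y‖ ≤ C * ‖f‖)
    (hinj : ∀ y : E, (y, (0 : E)) ∈ T.graph → y = 0) : BoundedlyInvertible T := by
  choose S hS hb using h
  have huniq : ∀ {y f}, (y, f) ∈ T.graph → y = S f := fun {y f} hy => by
    have := T.graph.sub_mem hy (hS f)
    rw [Prod.mk_sub_mk, sub_self] at this
    exact sub_eq_zero.1 (hinj _ this)
  let L : E →ₗ[ℂ] E :=
    { toFun := S
      map_add' := fun f g => (huniq (T.graph.add_mem (hS f) (hS g))).symm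
      map_smul' := fun c f => (huniq (T.graph.smul_mem c (hS f))).symm }
  exact ⟨L.mkContinuous C hb, hS, fun y => (huniq (T.mem_graph y)).symm⟩

theorem mem_opSpectrum_iff {T : E →ₗ.[ℂ] E} {l : ℂ} :
    l ∈ opSpectrum T ↔ ¬ BoundedlyInvertible (T - l • idOp E) := Iff.rfl

theorem isEigenvector_iff {T : E →ₗ.[ℂ] E} {l : ℂ} {u : E} :
    IsEigenvector T l u ↔ u ≠ 0 ∧ (u, (0 : E)) ∈ (T - l • idOp E).graph := by
  rw [mem_sub_smul_idOp_graph, zero_add]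
  refine and_congr_right fun _ => ⟨?_, fun h => ?_⟩
  · rintro ⟨h, hT⟩
    exact (LinearPMap.mem_graph_iff _).2 ⟨⟨u, h⟩, rfl, hT⟩
  · obtain ⟨⟨y, hy⟩, rfl, hT⟩ := (LinearPMap.mem_graph_iff _).1 h
    exact ⟨hy, hT⟩

theorem isPencilEigenvector_iff {T : ℂ → (E →ₗ.[ℂ] E)} {l : ℂ} {u : E} :
    IsPencilEigenvector T l u ↔ u ≠ 0 ∧ (u, (0 : E)) ∈ (T l).graph := by
  refine and_congr_right fun _ => ⟨?_, fun h => ?_⟩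
  · rintro ⟨h, hT⟩
    exact (LinearPMap.mem_graph_iff _).2 ⟨⟨u, h⟩, rfl, hT⟩
  · obtain ⟨⟨y, hy⟩, rfl, hT⟩ := (LinearPMap.mem_graph_iff _).1 h
    exact ⟨hy, hT⟩

end Operators

/-! ### Estimates in `L₂(0,1)` -/

/-- Total mass one gives `‖·‖₁ ≤ ‖·‖₂ ≤ ‖·‖_∞` with constant `1`, which links the `L¹` bounds for
systems to the Hilbert space norms. -/
instance : IsProbabilityMeasure vol01 := ⟨by simp⟩

theorem integral_norm_le_norm (G : L2) : ∫ t, ‖G t‖ ∂vol01 ≤ ‖G‖ := by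
  rw [Lp.norm_def, integral_norm_eq_lintegral_enorm (Lp.aestronglyMeasurable G),
    ← eLpNorm_one_eq_lintegral_enorm]
  exact ENNReal.toReal_mono (Lp.eLpNorm_ne_top G)
    (eLpNorm_le_eLpNorm_of_exponent_le one_le_two (Lp.aestronglyMeasurable G))

theorem integrable_L2 (G : L2) : Integrable G vol01 := (Lp.memLp G).integrable one_le_two

theorem norm_le_of_bound {Y : L2} {y : ℝ → ℂ} (hY : Y =ᵐ[vol01] y) {C : ℝ} (hC : 0 ≤ C)
    (h : ∀ x ∈ Icc (0 : ℝ) 1, ‖y x‖ ≤ C) : ‖Y‖ ≤ C := by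
  have := Lp.norm_le_of_ae_bound (f := Y) hC (by
    filter_upwards [hY, ae_restrict_mem measurableSet_Ioo] with x hx hm
    rw [hx]
    exact h x (Ioo_subset_Icc_self hm))
  simpa [measureUnivNNReal] using this

theorem ae_of_forall_Icc {P : ℝ → Prop} (h : ∀ x ∈ Icc (0 : ℝ) 1, P x) : ∀ᵐ x ∂vol01, P x := by
  filter_upwards [ae_restrict_mem measurableSet_Ioo] with x hx using h x (Ioo_subset_Icc_self hx)

theorem continuousOn_Icc_of_ac {X : Type*} [SeminormedAddCommGroup X] {f : ℝ → X}
    (hf : AbsolutelyContinuousOnInterval f 0 1) : ContinuousOn f (Icc 0 1) := by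
  have := hf.continuousOn
  rwa [uIcc_of_le zero_le_one] at this

theorem aestronglyMeasurable_of_ac {E : Type*} [NormedAddCommGroup E] {f : ℝ → E}
    (hf : AbsolutelyContinuousOnInterval f 0 1) : AEStronglyMeasurable f vol01 :=
  ((continuousOn_Icc_of_ac hf).mono Ioo_subset_Icc_self).aestronglyMeasurable measurableSet_Ioo

theorem memLp_smul_of_ac {E : Type*} [NormedAddCommGroup E] [NormedSpace ℝ E] {p : ℝ → ℝ}
    (hp : MemLp p 2 vol01) {y : ℝ → E} (hy : AbsolutelyContinuousOnInterval y 0 1) :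
    MemLp (fun x => p x • y x) 2 vol01 := by
  obtain ⟨C, hC⟩ := hy.exists_bound
  rw [uIcc_of_le zero_le_one] at hC
  refine MemLp.of_le_mul (c := C) hp (hp.1.smul (aestronglyMeasurable_of_ac hy)) ?_
  refine (ae_restrict_mem measurableSet_Ioo).mono fun x hx => ?_
  rw [norm_smul, mul_comm]
  exact mul_le_mul_of_nonneg_right (hC x (Ioo_subset_Icc_self hx)) (norm_nonneg _)

theorem memLp_of_ac {E : Type*} [NormedAddCommGroup E] [NormedSpace ℝ E] {y : ℝ → E}
    (hy : AbsolutelyContinuousOnInterval y 0 1) : MemLp y 2 vol01 := by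
  simpa using memLp_smul_of_ac (memLp_const (1 : ℝ)) hy

/-- The complex-valued function with the values of a real-valued one. -/
def cx (f : ℝ → ℝ) (x : ℝ) : ℂ := (f x : ℂ)

theorem memLp_cx {f : ℝ → ℝ} (hf : MemLp f 2 vol01) : MemLp (cx f) 2 vol01 := hf.ofReal

theorem integrable_cx {f : ℝ → ℝ} (hf : Integrable f vol01) : Integrable (cx f) vol01 := hf.ofReal

theorem IsSol.cx {a b c d F G y w : ℝ → ℝ} (h : IsSol a b c d F G y w) :
    IsSol (cx a) (cx b) (cx c) (cx d) (cx F) (cx G) (cx y) (cx w) := by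
  refine ⟨ac_ofReal h.ac_y, ac_ofReal h.ac_w, ?_, ?_⟩
  · filter_upwards [h.deriv_y] with x hx
    exact hx.ofReal_comp.congr_deriv (by simp [EnergyPencil.cx])
  · filter_upwards [h.deriv_w] with x hx
    exact hx.ofReal_comp.congr_deriv (by simp [EnergyPencil.cx])

theorem hasDerivAt_congr_Icc {E : Type*} [NormedAddCommGroup E] [NormedSpace ℝ E] {f g : ℝ → E}
    {f' : E} {x : ℝ} (h : EqOn g f (Icc 0 1)) (hx : x ∈ Ioo (0 : ℝ) 1) (hd : HasDerivAt f f' x) :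
    HasDerivAt g f' x := by
  refine hd.congr_of_eventuallyEq ?_
  filter_upwards [isOpen_Ioo.mem_nhds hx] with t ht using h (Ioo_subset_Icc_self ht)

theorem IsSol.congr_fst {𝕜 : Type*} [RCLike 𝕜] {a b c d F G y w y' : ℝ → 𝕜}
    (h : IsSol a b c d F G y w) (he : EqOn y' y (Icc 0 1)) : IsSol a b c d F G y' w := by
  refine ⟨ac_congr h.ac_y (by rwa [uIcc_of_le zero_le_one]), h.ac_w, ?_, ?_⟩
  · filter_upwards [h.deriv_y, ae_restrict_mem measurableSet_Ioo] with x hx hm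
    rw [he (Ioo_subset_Icc_self hm)]
    exact hasDerivAt_congr_Icc he hm hx
  · filter_upwards [h.deriv_w, ae_restrict_mem measurableSet_Ioo] with x hx hm
    rw [he (Ioo_subset_Icc_self hm)]
    exact hx

theorem IsSol.congr_rhs {𝕜 : Type*} [RCLike 𝕜] {a b c d F G F' G' y w : ℝ → 𝕜}
    (h : IsSol a b c d F G y w) (hF : F =ᵐ[vol01] F') (hG : G =ᵐ[vol01] G') :
    IsSol a b c d F' G' y w :=
  h.congr_ae (hF.mono fun x hx => by rw [hx]) (hG.mono fun x hx => by rw [hx])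

/-! ### The quadratic pencil as a first order system -/

/-- The coefficient `-(l² - 2 l p + r²)` of the first order system of the pencil. -/
def pencilCoeff (p r : ℝ → ℝ) (l : ℂ) (x : ℝ) : ℂ := -(l ^ 2 - 2 * l * p x + (r x : ℂ) ^ 2)

theorem integrable_pencilCoeff {p r : ℝ → ℝ} (hp : MemLp p 2 vol01) (hr : MemLp r 2 vol01)
    (l : ℂ) : Integrable (pencilCoeff p r l) vol01 := by
  have h1 := integrable_cx (hp.integrable one_le_two)
  have h2 := integrable_cx hr.integrable_sq
  refine (((integrable_const (l ^ 2)).sub (h1.const_mul (2 * l))).add h2).neg.congr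
    (Eventually.of_forall fun x => ?_)
  simp [pencilCoeff, cx]

/-- Solving `T_j(l) y = G` for `ℓ(y) = l² y - 2 l p y - G` and inserting this in the equation for
the quasi-derivative yields the system. -/
theorem mem_pencil_graph {p r : ℝ → ℝ} (hp : MemLp p 2 vol01) {j : BC} {l : ℂ} {Y G : L2} :
    (Y, G) ∈ (pencil p r j l).graph ↔ ∃ y w : ℝ → ℂ, Y =ᵐ[vol01] y ∧
      IsSol (cx r) 1 (pencilCoeff p r l) (-cx r) 0 G y w ∧ y 0 = 0 ∧ j.pick (w 1) (y 1) = 0 := by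
  simp only [pencil, mem_sub_graph, mem_smul_graph, mem_idOp_graph, mulOp_graph, slOp_graph]
  constructor
  · rintro ⟨a, f, ⟨a₁, b₁, ⟨Y, rfl, rfl⟩, ⟨b, hb, rfl⟩, rfl⟩, ⟨y, w, hy, h, h0, h1⟩, rfl⟩
    refine ⟨y, w, hy, ⟨h.ac_y, h.ac_w, ?_, ?_⟩, h0, h1⟩
    · filter_upwards [h.deriv_y] with x hx
      exact hx.congr_deriv (by simp [cx, add_comm])
    · change ∀ᵐ x ∂vol01, b x = p x • Y x at hb
      filter_upwards [h.deriv_w, hb, hy, Lp.coeFn_sub (l ^ 2 • Y - (2 * l) • b) f,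
        Lp.coeFn_sub (l ^ 2 • Y) ((2 * l) • b), Lp.coeFn_smul (l ^ 2) Y,
        Lp.coeFn_smul (2 * l) b] with x hx e1 e2 e3 e4 e5 e6
      refine hx.congr_deriv ?_
      simp only [e3, e4, e5, e6, Pi.sub_apply, Pi.smul_apply, Pi.neg_apply, e1, e2, smul_eq_mul,
        Complex.real_smul, pencilCoeff, cx, Complex.ofReal_pow]
      ring
  · rintro ⟨y, w, hy, h, h0, h1⟩
    -- The product `p y` is in `L₂` because `y` is bounded, so `y` lies in the domain of
    -- multiplication by `p`.
    obtain ⟨B, hB⟩ : ∃ B : L2, B =ᵐ[vol01] fun x => p x • y x :=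
      ⟨_, (memLp_smul_of_ac hp h.ac_y).coeFn_toLp⟩
    refine ⟨_, l ^ 2 • Y - (2 * l) • B - G, ⟨_, _, ⟨Y, rfl, rfl⟩, ⟨B, ?_, rfl⟩, rfl⟩,
      ⟨y, w, hy, ⟨h.ac_y, h.ac_w, ?_, ?_⟩, h0, h1⟩, by abel⟩
    · change ∀ᵐ x ∂vol01, _
      filter_upwards [hB, hy] with x hx hx1
      rw [hx, hx1]
    · filter_upwards [h.deriv_y] with x hx
      exact hx.congr_deriv (by simp [cx, add_comm])
    · filter_upwards [h.deriv_w, hy, Lp.coeFn_sub (l ^ 2 • Y - (2 * l) • B) G,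
        Lp.coeFn_sub (l ^ 2 • Y) ((2 * l) • B), Lp.coeFn_smul (l ^ 2) Y,
        Lp.coeFn_smul (2 * l) B, hB] with x hx e2 e3 e4 e5 e6 e1
      refine hx.congr_deriv ?_
      simp only [e3, e4, e5, e6, Pi.sub_apply, Pi.smul_apply, Pi.neg_apply, e1, e2, smul_eq_mul,
        Complex.real_smul, pencilCoeff, cx, Complex.ofReal_pow]
      ring

/-- A solution of the homogeneous system of the pencil whose first component vanishes is zero. -/
theorem IsSol.snd_eq_zero {𝕜 : Type*} [RCLike 𝕜] {a c d G y w : ℝ → 𝕜}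
    (h : IsSol a 1 c d 0 G y w)
    (hy : EqOn y 0 (Icc 0 1)) : EqOn w 0 (Icc 0 1) := by
  refine eqOn_of_ac h.ac_w (ac_const 0 0 1) ?_
  filter_upwards [h.deriv_y, ae_restrict_mem measurableSet_Ioo] with x hx hm
  have := hasDerivAt_eq_zero hy hm hx
  simpa [hy (Ioo_subset_Icc_self hm)] using this

/-- The Fredholm alternative. Triviality is expressed by `w 0 = 0`, which together with `y 0 = 0` is
zero Cauchy data. -/
theorem pencil_boundedlyInvertible_iff {p r : ℝ → ℝ} (hp : MemLp p 2 vol01)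
    (hr : MemLp r 2 vol01) {j : BC} {l : ℂ} :
    BoundedlyInvertible (pencil p r j l) ↔
      ∀ y w, IsSol (cx r) 1 (pencilCoeff p r l) (-cx r) 0 0 y w → y 0 = 0 →
        j.pick (w 1) (y 1) = 0 → w 0 = 0 := by
  have ha := integrable_cx (hr.integrable one_le_two)
  have hb : Integrable (1 : ℝ → ℂ) vol01 := integrable_const 1
  have hc := integrable_pencilCoeff hp hr l
  constructor
  · intro hT y w h h0 h1
    have hm := memLp_of_ac h.ac_y
    have hz : ((0 : L2) : ℝ → ℂ) =ᵐ[vol01] 0 := Lp.coeFn_zero _ _ _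
    have := hT.eq_zero ((mem_pencil_graph hp).2 ⟨y, w, hm.coeFn_toLp,
      h.congr_rhs EventuallyEq.rfl hz.symm, h0, h1⟩)
    have hy : EqOn y 0 (Icc 0 1) := by
      refine eqOn_of_ac h.ac_y ac_zero (hm.coeFn_toLp.symm.trans ?_)
      rw [this]
      exact hz
    exact h.snd_eq_zero hy (left_mem_Icc.2 zero_le_one)
  · intro huniq
    obtain ⟨C, hC0, hC⟩ := exists_bvp_solution ha hb hc ha.neg j huniq
    refine boundedlyInvertible_of_bound (C := C) (fun G => ?_) fun Y hY => ?_
    · obtain ⟨y, w, h, h0, h1, hbd⟩ := hC 0 G (integrable_zero _ _ _) (integrable_L2 G)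
      have hm := memLp_of_ac h.ac_y
      refine ⟨hm.toLp y, (mem_pencil_graph hp).2 ⟨y, w, hm.coeFn_toLp, h, h0, h1⟩, ?_⟩
      refine norm_le_of_bound hm.coeFn_toLp (by positivity) fun x hx => (hbd x hx).1.trans ?_
      refine mul_le_mul_of_nonneg_left ?_ hC0
      simpa using integral_norm_le_norm G
    · obtain ⟨y, w, hy, h, h0, h1⟩ := (mem_pencil_graph hp).1 hY
      have h' := h.congr_rhs EventuallyEq.rfl (Lp.coeFn_zero _ _ _ : ((0 : L2) : ℝ → ℂ) =ᵐ[vol01] 0)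
      have hz := h'.eq_zero ha hb hc ha.neg h0 (huniq y w h' h0 h1)
      refine (Lp.eq_zero_iff_ae_eq_zero).2 (hy.trans ?_)
      exact ae_of_forall_Icc fun x hx => (hz x hx).1

/-- The pencil spectrum is defined by `0 ∈ opSpectrum (T l)`; subtracting `0 • idOp` changes neither
domain nor values. -/
theorem mem_pencilSpectrum_iff {p r : ℝ → ℝ} {j : BC} {l : ℂ} :
    l ∈ pencilSpectrum (pencil p r j) ↔ ¬ BoundedlyInvertible (pencil p r j l) := by
  have e : pencil p r j l - (0 : ℂ) • idOp L2 = pencil p r j l := by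
    refine LinearPMap.eq_of_eq_graph ?_
    ext ⟨x, z⟩
    rw [mem_sub_smul_idOp_graph, zero_smul, add_zero]
  change ¬ BoundedlyInvertible (pencil p r j l - (0 : ℂ) • idOp L2) ↔ _
  rw [e]

theorem isPencilEigenfunction_iff {p r : ℝ → ℝ} (hp : MemLp p 2 vol01) (hr : MemLp r 2 vol01)
    {j : BC} {l : ℂ} {y : ℝ → ℂ} (hy : AbsolutelyContinuousOnInterval y 0 1) :
    IsPencilEigenfunction p r j l y ↔
      ∃ w, IsSol (cx r) 1 (pencilCoeff p r l) (-cx r) 0 0 y w ∧ y 0 = 0 ∧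
        j.pick (w 1) (y 1) = 0 ∧ w 0 ≠ 0 := by
  have ha := integrable_cx (hr.integrable one_le_two)
  have hb : Integrable (1 : ℝ → ℂ) vol01 := integrable_const 1
  have hc := integrable_pencilCoeff hp hr l
  have hz : ((0 : L2) : ℝ → ℂ) =ᵐ[vol01] 0 := Lp.coeFn_zero _ _ _
  have hm := memLp_of_ac hy
  have h01 : (0 : ℝ) ∈ Icc (0 : ℝ) 1 := left_mem_Icc.2 zero_le_one
  have h11 : (1 : ℝ) ∈ Icc (0 : ℝ) 1 := right_mem_Icc.2 zero_le_one
  constructor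
  · rintro ⟨hm, h⟩
    obtain ⟨hne, h⟩ := isPencilEigenvector_iff.1 h
    obtain ⟨y', w, hy', h, h0, h1⟩ := (mem_pencil_graph hp).1 h
    have he : EqOn y y' (Icc 0 1) := eqOn_of_ac hy h.ac_y (hm.coeFn_toLp.symm.trans hy')
    have h' := (h.congr_rhs EventuallyEq.rfl hz).congr_fst he
    rw [← he h01] at h0
    rw [← he h11] at h1
    refine ⟨w, h', h0, h1, fun hw => hne ?_⟩
    have h2 := h'.eq_zero ha hb hc ha.neg h0 hw
    exact (Lp.eq_zero_iff_ae_eq_zero).2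
      (hm.coeFn_toLp.trans (ae_of_forall_Icc fun x hx => (h2 x hx).1))
  · rintro ⟨w, h, h0, h1, hw⟩
    refine ⟨hm, isPencilEigenvector_iff.2 ⟨fun he => hw ?_, (mem_pencil_graph hp).2
      ⟨y, w, hm.coeFn_toLp, h.congr_rhs EventuallyEq.rfl hz.symm, h0, h1⟩⟩⟩
    refine h.snd_eq_zero (eqOn_of_ac hy ac_zero (hm.coeFn_toLp.symm.trans ?_)) h01
    rw [he]
    exact hz

/-! ### The Dirac operator as a first order system -/

/-- The coefficient `2 p - m - l` of the Dirac system. -/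
def diracCoeff (p : ℝ → ℝ) (m : ℝ) (l : ℂ) (x : ℝ) : ℂ := 2 * p x - m - l

theorem integrable_diracCoeff {p : ℝ → ℝ} (hp : MemLp p 2 vol01) (m : ℝ) (l : ℂ) :
    Integrable (diracCoeff p m l) vol01 :=
  (((integrable_cx (hp.integrable one_le_two)).const_mul 2).sub (integrable_const _)).sub
    (integrable_const _)

theorem dirac_rows (p : ℝ → ℝ) (m : ℝ) (z : ℝ → ℝ) (x : ℝ) (a b c d e f : ℂ) :
    ![e, f] = J.mulVec ![c, d] + (miuraP p m z x).mulVec ![a, b] ↔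
      e = d + m * a - miuraV z x * b ∧ f = -c - miuraV z x * a + (2 * p x - m) * b := by
  have h : J.mulVec ![c, d] + (miuraP p m z x).mulVec ![a, b] =
      ![d + m * a - miuraV z x * b, -c - miuraV z x * a + (2 * p x - m) * b] := by
    ext i
    fin_cases i
    · simp [J, miuraP]; ring
    · simp [J, miuraP]; ring
  rw [h]
  constructor
  · intro h
    exact ⟨congrFun h 0, congrFun h 1⟩
  · rintro ⟨rfl, rfl⟩
    rfl

/-- The two rows solved for the derivatives: `u₂' = v u₂ + (l - m) u₁ + G₁` and `u₁' = (2p - m - l)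
u₂ - v u₁ - G₂`. The unknowns are swapped so that the shape matches the system of the pencil. -/
theorem mem_dirac_graph {p z : ℝ → ℝ} {m : ℝ} (hp : MemLp p 2 vol01)
    (hv : MemLp (miuraV z) 2 vol01) {j : BC} {l : ℂ} {U G : L2xL2} :
    (U, G) ∈ (diracOp (miuraP p m z) j - l • idOp L2xL2).graph ↔
      ∃ u₁ u₂ : ℝ → ℂ, U.fst =ᵐ[vol01] u₁ ∧ U.snd =ᵐ[vol01] u₂ ∧
        IsSol (cx (miuraV z)) (fun _ => l - m) (diracCoeff p m l) (-cx (miuraV z))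
          G.fst (-(G.snd : ℝ → ℂ)) u₂ u₁ ∧ u₂ 0 = 0 ∧ j.pick (u₁ 1) (u₂ 1) = 0 := by
  rw [mem_sub_smul_idOp_graph, diracOp_graph]
  constructor
  · rintro ⟨u₁, u₂, u₁', u₂', h1, h2, h3, h4, h5, h6, h7⟩
    have key : ∀ᵐ x ∂vol01, G.fst x + l * u₁ x = u₂' x + m * u₁ x - miuraV z x * u₂ x ∧
        G.snd x + l * u₂ x = -u₁' x - miuraV z x * u₁ x + (2 * p x - m) * u₂ x := by
      filter_upwards [h7, h1, h2, Lp.coeFn_add G.fst (l • U.fst), Lp.coeFn_add G.snd (l • U.snd),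
        Lp.coeFn_smul l U.fst, Lp.coeFn_smul l U.snd] with x e e1 e2 e3 e4 e5 e6
      rw [dirac_rows] at e
      simpa only [WithLp.add_fst, WithLp.smul_fst, WithLp.add_snd, WithLp.smul_snd, e3, e4,
        Pi.add_apply, e5, e6, Pi.smul_apply, e1, e2, smul_eq_mul] using e
    refine ⟨u₁, u₂, h1, h2, ⟨h4.ac, h3.ac, ?_, ?_⟩, h5, h6⟩
    · filter_upwards [h4.hasDeriv, key] with x hx e
      refine hx.congr_deriv ?_
      simp only [cx]
      linear_combination -e.1
    · filter_upwards [h3.hasDeriv, key] with x hx e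
      refine hx.congr_deriv ?_
      simp only [cx, diracCoeff, Pi.neg_apply]
      linear_combination e.2
  · rintro ⟨u₁, u₂, h1, h2, h, h5, h6⟩
    refine ⟨u₁, u₂, _, _, h1, h2, ⟨h.ac_w, h.deriv_w, ?_⟩, ⟨h.ac_y, h.deriv_y, ?_⟩, h5, h6, ?_⟩
    · have e1 := (memLp_smul_of_ac hp h.ac_y).const_mul 2
      have e2 := (memLp_of_ac h.ac_y).const_mul ((m : ℂ) + l)
      have e3 := memLp_smul_of_ac hv h.ac_w
      refine (((e1.sub e2).sub e3).sub (Lp.memLp G.snd)).ae_eq (Eventually.of_forall fun x => ?_)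
      simp only [cx, diracCoeff, Pi.neg_apply, Pi.sub_apply, Complex.real_smul]
      ring
    · have e1 := memLp_smul_of_ac hv h.ac_y
      have e2 := (memLp_of_ac h.ac_w).const_mul (l - m)
      refine ((e1.add e2).add (Lp.memLp G.fst)).ae_eq (Eventually.of_forall fun x => ?_)
      simp only [cx, Pi.add_apply, Complex.real_smul]
    · filter_upwards [h1, h2, Lp.coeFn_add G.fst (l • U.fst), Lp.coeFn_add G.snd (l • U.snd),
        Lp.coeFn_smul l U.fst, Lp.coeFn_smul l U.snd] with x e1 e2 e3 e4 e5 e6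
      rw [dirac_rows]
      simp only [WithLp.add_fst, WithLp.smul_fst, WithLp.add_snd, WithLp.smul_snd, e3, e4,
        Pi.add_apply, e5, e6, Pi.smul_apply, e1, e2, smul_eq_mul, cx, diracCoeff, Pi.neg_apply]
      constructor <;> ring

theorem norm_le_of_norm_fst_snd_le {U : L2xL2} {C : ℝ} (h1 : ‖U.fst‖ ≤ C) (h2 : ‖U.snd‖ ≤ C) :
    ‖U‖ ≤ 2 * C := by
  have h := WithLp.prod_norm_sq_eq_of_L2 U
  have := norm_nonneg U.fst
  have := norm_nonneg U.snd
  have := mul_le_mul h1 h1 (norm_nonneg _) (by linarith)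
  have := mul_le_mul h2 h2 (norm_nonneg _) (by linarith)
  exact (sq_le_sq₀ (norm_nonneg _) (by linarith)).1 (by nlinarith)

theorem L2xL2_ext {U V : L2xL2} (h1 : U.fst = V.fst) (h2 : U.snd = V.snd) : U = V :=
  WithLp.ofLp_injective 2 (Prod.ext h1 h2)

theorem dirac_boundedlyInvertible_iff {p z : ℝ → ℝ} {m : ℝ} (hp : MemLp p 2 vol01)
    (hv : MemLp (miuraV z) 2 vol01) {j : BC} {l : ℂ} :
    BoundedlyInvertible (diracOp (miuraP p m z) j - l • idOp L2xL2) ↔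
      ∀ y u, IsSol (cx (miuraV z)) (fun _ => l - m) (diracCoeff p m l) (-cx (miuraV z)) 0 0 y u →
        y 0 = 0 → j.pick (u 1) (y 1) = 0 → u 0 = 0 := by
  have ha := integrable_cx (hv.integrable one_le_two)
  have hb : Integrable (fun _ : ℝ => l - m) vol01 := integrable_const _
  have hc := integrable_diracCoeff hp m l
  have hz : ((0 : L2) : ℝ → ℂ) =ᵐ[vol01] 0 := Lp.coeFn_zero _ _ _
  have hz' : (-((0 : L2) : ℝ → ℂ)) =ᵐ[vol01] 0 := by simpa using hz.neg
  constructor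
  · intro hT y u h h0 h1
    have hm := memLp_of_ac h.ac_y
    have hmu := memLp_of_ac h.ac_w
    have hU := hT.eq_zero (y := WithLp.toLp 2 (hmu.toLp u, hm.toLp y))
      ((mem_dirac_graph hp hv).2 ⟨u, y, hmu.coeFn_toLp, hm.coeFn_toLp,
        h.congr_rhs hz.symm hz'.symm, h0, h1⟩)
    have hu : hmu.toLp u = 0 := congrArg WithLp.fst hU
    refine eqOn_of_ac h.ac_w ac_zero (hmu.coeFn_toLp.symm.trans ?_) (left_mem_Icc.2 zero_le_one)
    rw [hu]
    exact hz
  · intro huniq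
    obtain ⟨C, hC0, hC⟩ := exists_bvp_solution ha hb hc ha.neg j huniq
    -- The inner `2` adds the two forcing terms, each at most `‖G‖`; the outer `2` combines the two
    -- components of the solution.
    refine boundedlyInvertible_of_bound (C := 2 * (C * 2)) (fun G => ?_) fun U hU => ?_
    · obtain ⟨y, u, h, h0, h1, hbd⟩ := hC G.fst (-(G.snd : ℝ → ℂ)) (integrable_L2 _)
        (integrable_L2 _).neg
      have hm := memLp_of_ac h.ac_y
      have hmu := memLp_of_ac h.ac_w
      refine ⟨WithLp.toLp 2 (hmu.toLp u, hm.toLp y), (mem_dirac_graph hp hv).2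
        ⟨u, y, hmu.coeFn_toLp, hm.coeFn_toLp, h, h0, h1⟩, ?_⟩
      have hG : C * ((∫ t, ‖G.fst t‖ ∂vol01) + ∫ t, ‖(-(G.snd : ℝ → ℂ)) t‖ ∂vol01) ≤
          C * 2 * ‖G‖ := by
        rw [mul_assoc]
        refine mul_le_mul_of_nonneg_left ?_ hC0
        have e1 := (integral_norm_le_norm G.fst).trans (WithLp.norm_fst_le _ G)
        have e2 := (integral_norm_le_norm G.snd).trans (WithLp.norm_snd_le _ G)
        simp only [Pi.neg_apply, norm_neg]
        linarith
      rw [mul_assoc 2 (C * 2)]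
      exact norm_le_of_norm_fst_snd_le
        (norm_le_of_bound hmu.coeFn_toLp (by positivity) fun x hx => (hbd x hx).2.trans hG)
        (norm_le_of_bound hm.coeFn_toLp (by positivity) fun x hx => (hbd x hx).1.trans hG)
    · obtain ⟨u, y, hu, hy, h, h0, h1⟩ := (mem_dirac_graph hp hv).1 hU
      have h' := h.congr_rhs hz hz'
      have hall := h'.eq_zero ha hb hc ha.neg h0 (huniq y u h' h0 h1)
      exact L2xL2_ext
        ((Lp.eq_zero_iff_ae_eq_zero).2 (hu.trans (ae_of_forall_Icc fun x hx => (hall x hx).2)))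
        ((Lp.eq_zero_iff_ae_eq_zero).2 (hy.trans (ae_of_forall_Icc fun x hx => (hall x hx).1)))

/-- The function `u` is matched only almost everywhere, since it will be built from `deriv y`. -/
theorem isDiracEigenfunction_iff {p z : ℝ → ℝ} {m : ℝ} (hp : MemLp p 2 vol01)
    (hv : MemLp (miuraV z) 2 vol01) {j : BC} {l : ℂ} {u y : ℝ → ℂ}
    (hy : AbsolutelyContinuousOnInterval y 0 1) :
    IsDiracEigenfunction (miuraP p m z) j l u y ↔
      ∃ u₁, u =ᵐ[vol01] u₁ ∧
        IsSol (cx (miuraV z)) (fun _ => l - m) (diracCoeff p m l) (-cx (miuraV z)) 0 0 y u₁ ∧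
        y 0 = 0 ∧ j.pick (u₁ 1) (y 1) = 0 ∧ u₁ 0 ≠ 0 := by
  have ha := integrable_cx (hv.integrable one_le_two)
  have hb : Integrable (fun _ : ℝ => l - m) vol01 := integrable_const _
  have hc := integrable_diracCoeff hp m l
  have hz : ((0 : L2) : ℝ → ℂ) =ᵐ[vol01] 0 := Lp.coeFn_zero _ _ _
  have hz' : (-((0 : L2) : ℝ → ℂ)) =ᵐ[vol01] 0 := by simpa using hz.neg
  have h01 : (0 : ℝ) ∈ Icc (0 : ℝ) 1 := left_mem_Icc.2 zero_le_one
  have h11 : (1 : ℝ) ∈ Icc (0 : ℝ) 1 := right_mem_Icc.2 zero_le_one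
  constructor
  · rintro ⟨hmu, hm, h⟩
    obtain ⟨hne, h⟩ := isEigenvector_iff.1 h
    obtain ⟨u', y', hu', hy', h, h0, h1⟩ := (mem_dirac_graph hp hv).1 h
    have he : EqOn y y' (Icc 0 1) := eqOn_of_ac hy h.ac_y (hm.coeFn_toLp.symm.trans hy')
    have h' := (h.congr_rhs hz hz').congr_fst he
    rw [← he h01] at h0
    rw [← he h11] at h1
    refine ⟨u', hmu.coeFn_toLp.symm.trans hu', h', h0, h1, fun hu => hne ?_⟩
    have h2 := h'.eq_zero ha hb hc ha.neg h0 hu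
    exact L2xL2_ext
      ((Lp.eq_zero_iff_ae_eq_zero).2 (hu'.trans (ae_of_forall_Icc fun x hx => (h2 x hx).2)))
      ((Lp.eq_zero_iff_ae_eq_zero).2
        (hm.coeFn_toLp.trans (ae_of_forall_Icc fun x hx => (h2 x hx).1)))
  · rintro ⟨u', hu', h, h0, h1, hne⟩
    have hm := memLp_of_ac hy
    have hmu : MemLp u 2 vol01 := (memLp_congr_ae hu').2 (memLp_of_ac h.ac_w)
    refine ⟨hmu, hm, isEigenvector_iff.2 ⟨fun he => hne ?_, (mem_dirac_graph hp hv).2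
      ⟨u', y, hmu.coeFn_toLp.trans hu', hm.coeFn_toLp, h.congr_rhs hz.symm hz'.symm, h0, h1⟩⟩⟩
    have hu : hmu.toLp u = 0 := congrArg WithLp.fst he
    refine eqOn_of_ac h.ac_w ac_zero (hu'.symm.trans (hmu.coeFn_toLp.symm.trans ?_)) h01
    rw [hu]
    exact hz

/-! ### Real solutions of the homogeneous equation -/

/-- The coefficient `-(m² - 2 m p + r²)` for a real spectral parameter. -/
def realCoeff (p r : ℝ → ℝ) (m : ℝ) (x : ℝ) : ℝ := -(m ^ 2 - 2 * m * p x + r x ^ 2)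

theorem cx_realCoeff (p r : ℝ → ℝ) (m : ℝ) : cx (realCoeff p r m) = pencilCoeff p r m := by
  ext x
  simp [cx, realCoeff, pencilCoeff]

theorem integrable_realCoeff {p r : ℝ → ℝ} (hp : MemLp p 2 vol01) (hr : MemLp r 2 vol01)
    (m : ℝ) : Integrable (realCoeff p r m) vol01 :=
  (((integrable_const (m ^ 2)).sub ((hp.integrable one_le_two).const_mul (2 * m))).add
    hr.integrable_sq).neg

theorem isEll_iff_isSol {p r z w : ℝ → ℝ} {m : ℝ} :
    IsEll r z w (fun x => m ^ 2 * z x - 2 * m * p x * z x) ↔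
      IsSol r 1 (realCoeff p r m) (-r) 0 0 z w := by
  constructor
  · intro h
    refine ⟨h.ac_y, h.ac_w, ?_, ?_⟩
    · filter_upwards [h.deriv_y] with x hx
      exact hx.congr_deriv (by simp [add_comm])
    · filter_upwards [h.deriv_w] with x hx
      refine hx.congr_deriv ?_
      simp only [realCoeff, smul_eq_mul, Pi.neg_apply, Pi.zero_apply]
      ring
  · intro h
    refine ⟨h.ac_y, h.ac_w, ?_, ?_⟩
    · filter_upwards [h.deriv_y] with x hx
      exact hx.congr_deriv (by simp [add_comm])
    · filter_upwards [h.deriv_w] with x hx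
      refine hx.congr_deriv ?_
      simp only [realCoeff, smul_eq_mul, Pi.neg_apply, Pi.zero_apply]
      ring

theorem exists_isMiuraSolution {p r : ℝ → ℝ} (hp : MemLp p 2 vol01) (hr : MemLp r 2 vol01)
    (m : ℝ) : ∃ z, IsMiuraSolution p r m z := by
  have ha := hr.integrable one_le_two
  have hb : Integrable (1 : ℝ → ℝ) vol01 := integrable_const 1
  have hc := integrable_realCoeff hp hr m
  have h0 : Integrable (0 : ℝ → ℝ) vol01 := integrable_zero _ _ _
  have h11 : (1 : ℝ) ∈ Icc (0 : ℝ) 1 := right_mem_Icc.2 zero_le_one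
  obtain ⟨y₁, w₁, h₁, hy₁, hw₁⟩ := exists_isSol ha hb hc ha.neg h0 h0 1 0
  obtain ⟨y₂, w₂, h₂, hy₂, hw₂⟩ := exists_isSol ha hb hc ha.neg h0 h0 0 1
  -- The data are prescribed at `1` but the Cauchy problem starts at `0`. The fundamental matrix at
  -- `1` has determinant one, and its inverse sends `(1, 0)` to `(w₂ 1, -w₁ 1)`.
  obtain ⟨z, w, h, hz, hw⟩ := exists_isSol ha hb hc ha.neg h0 h0 (w₂ 1) (-w₁ 1)
  have e := h₁.wronskian h₂ 1 h11
  have e₁ := h.wronskian h₁ 1 h11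
  have e₂ := h.wronskian h₂ 1 h11
  rw [hy₁, hw₁, hy₂, hw₂] at e
  rw [hz, hw, hy₁, hw₁] at e₁
  rw [hz, hw, hy₂, hw₂] at e₂
  refine ⟨z, w, isEll_iff_isSol.2 h, ?_, ?_⟩
  · linear_combination y₁ 1 * e₂ - y₂ 1 * e₁ + (1 - z 1) * e
  · linear_combination w₁ 1 * e₂ - w₂ 1 * e₁ - w 1 * e

/-- The form in which negativity is used: `y` belongs to the domain of `A_1`, its image under
`T_1(m)` is `G`, and the integral is the quadratic form. -/
theorem eqOn_zero_of_isNegative {p r : ℝ → ℝ} (hp : MemLp p 2 vol01) {m : ℝ}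
    (hA : IsNegative (pencil p r BC.one m)) {G y w : ℝ → ℝ} (hG : MemLp G 2 vol01)
    (h : IsSol r 1 (realCoeff p r m) (-r) 0 G y w) (h0 : y 0 = 0) (h1 : w 1 = 0)
    (hGy : 0 ≤ ∫ x, G x * y x ∂vol01) : EqOn y 0 (Icc 0 1) := by
  have hm : MemLp (cx y) 2 vol01 := memLp_cx (memLp_of_ac h.ac_y)
  have hGm : MemLp (cx G) 2 vol01 := memLp_cx hG
  have hsol : IsSol (cx r) 1 (pencilCoeff p r m) (-cx r) 0 (hGm.toLp (cx G)) (cx y) (cx w) := by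
    have h' := h.cx
    rw [cx_realCoeff] at h'
    refine (h'.congr_ae (F' := 0) (G' := cx G) ?_ ?_).congr_rhs EventuallyEq.rfl
      hGm.coeFn_toLp.symm
    · exact Eventually.of_forall fun x => by simp [cx]
    · exact Eventually.of_forall fun x => by simp [cx]
  have hmem : (hm.toLp (cx y), hGm.toLp (cx G)) ∈ (pencil p r BC.one m).graph :=
    (mem_pencil_graph hp).2 ⟨cx y, cx w, hm.coeFn_toLp, hsol, by simp [cx, h0],
      by simp [cx, h1, BC.pick]⟩
  have hzero : hm.toLp (cx y) = 0 := by
    by_contra hne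
    obtain ⟨Y, hY, hT⟩ := (LinearPMap.mem_graph_iff _).1 hmem
    have hneg := hA Y (by rw [hY]; exact hne)
    rw [hT, hY, L2.inner_def] at hneg
    have e : ∫ x, inner ℂ (hGm.toLp (cx G) x) (hm.toLp (cx y) x) ∂vol01 =
        ((∫ x, G x * y x ∂vol01 : ℝ) : ℂ) := by
      rw [← integral_complex_ofReal]
      refine integral_congr_ae ?_
      filter_upwards [hGm.coeFn_toLp, hm.coeFn_toLp] with x e1 e2
      rw [e1, e2]
      simp [cx, mul_comm]
    rw [e, Complex.ofReal_re] at hneg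
    exact absurd hGy (not_le.2 hneg)
  have hcx : EqOn (cx y) 0 (Icc 0 1) := by
    refine eqOn_of_ac (ac_ofReal h.ac_y) ac_zero (hm.coeFn_toLp.symm.trans ?_)
    rw [hzero]
    exact Lp.coeFn_zero _ _ _
  intro x hx
  simpa [cx] using hcx hx

theorem not_ae_notMem_Ioo {α β : ℝ} (h0 : 0 ≤ α) (hαβ : α < β) (h1 : β ≤ 1) :
    ¬ ∀ᵐ x ∂vol01, x ∉ Ioo α β := by
  intro h
  rw [ae_iff] at h
  have e : {x : ℝ | ¬ x ∉ Ioo α β} = Ioo α β := by ext; simp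
  rw [e, Measure.restrict_apply measurableSet_Ioo,
    inter_eq_left.2 (Ioo_subset_Ioo h0 h1), Real.volume_Ioo, ENNReal.ofReal_eq_zero] at h
  linarith

/-- The Green function of a negative problem has constant sign on the diagonal. -/
theorem green_diagonal_nonneg {p r : ℝ → ℝ} (hp : MemLp p 2 vol01) {m : ℝ}
    (hA : IsNegative (pencil p r BC.one m)) {z w φ ψ : ℝ → ℝ}
    (h : IsSol r 1 (realCoeff p r m) (-r) 0 0 z w)
    (h' : IsSol r 1 (realCoeff p r m) (-r) 0 0 φ ψ) (hw : w 1 = 0) (hφ : φ 0 = 0) (hψ : ψ 0 = 1)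
    (hz0 : z 0 ≠ 0) : ∀ x ∈ Ioo (0 : ℝ) 1, 0 ≤ z 0 * φ x * z x := by
  intro x₀ hx₀
  by_contra! hneg
  set c := z 0 with hc_def
  have hW : ∀ x ∈ Icc (0 : ℝ) 1, z x * ψ x - w x * φ x = c := fun x hx => by
    rw [h.wronskian h' x hx, hφ, hψ]; ring
  have hzc := continuousOn_Icc_of_ac h.ac_y
  have hφc := continuousOn_Icc_of_ac h'.ac_y
  -- The sign is spread to independent arguments `s` and `t`, because the Green kernel evaluates `φ`
  -- and `z` at different points.
  obtain ⟨ε, hε, hball⟩ : ∃ ε > 0, ∀ s ∈ Metric.ball x₀ ε, ∀ t ∈ Metric.ball x₀ ε,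
      s ∈ Icc (0 : ℝ) 1 ∧ c * φ s * z t < 0 := by
    have hnhds : Icc (0 : ℝ) 1 ∈ 𝓝 x₀ := Icc_mem_nhds hx₀.1 hx₀.2
    have hcont : ContinuousAt (fun q : ℝ × ℝ => c * φ q.1 * z q.2) (x₀, x₀) := by
      have h1 : ContinuousAt (fun q : ℝ × ℝ => φ q.1) (x₀, x₀) :=
        ContinuousAt.comp (f := Prod.fst) (hφc.continuousAt hnhds) continuousAt_fst
      have h2 : ContinuousAt (fun q : ℝ × ℝ => z q.2) (x₀, x₀) :=
        ContinuousAt.comp (f := Prod.snd) (hzc.continuousAt hnhds) continuousAt_snd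
      exact (continuousAt_const.mul h1).mul h2
    have hev := (hcont.eventually_lt continuousAt_const hneg)
    obtain ⟨ε₁, hε₁, hb₁⟩ := Metric.eventually_nhds_iff_ball.1 hev
    obtain ⟨ε₂, hε₂, hb₂⟩ := Metric.mem_nhds_iff.1 hnhds
    refine ⟨min ε₁ ε₂, lt_min hε₁ hε₂, fun s hs t ht => ⟨hb₂ ?_, hb₁ (s, t) ?_⟩⟩
    · exact Metric.ball_subset_ball (min_le_right _ _) hs
    · rw [← ball_prod_same]
      exact ⟨Metric.ball_subset_ball (min_le_left _ _) hs,
        Metric.ball_subset_ball (min_le_left _ _) ht⟩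
  set f : ℝ → ℝ := (Metric.ball x₀ ε).indicator 1 with hf_def
  have hf0 : ∀ x, 0 ≤ f x := fun x => indicator_nonneg (fun _ _ => zero_le_one) x
  have hfm : MemLp f 2 vol01 :=
    (memLp_const (1 : ℝ)).indicator Metric.isOpen_ball.measurableSet
  have hfi : Integrable f vol01 := hfm.integrable one_le_two
  have hzf : IntervalIntegrable (fun x => f x * z x) volume 0 1 :=
    intervalIntegrable_of_integrable_Ioo zero_le_one (integrable_mul_continuousOn hfi hzc)
  have hφf : IntervalIntegrable (fun x => f x * φ x) volume 0 1 :=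
    intervalIntegrable_of_integrable_Ioo zero_le_one (integrable_mul_continuousOn hfi hφc)
  set A : ℝ → ℝ := fun x => (∫ t in (0 : ℝ)..1, f t * z t) - ∫ t in (0 : ℝ)..x, f t * z t
    with hA_def
  set B : ℝ → ℝ := fun x => ∫ t in (0 : ℝ)..x, f t * φ t with hB_def
  have hAac : AbsolutelyContinuousOnInterval A 0 1 := (ac_const _ 0 1).sub (ac_integral hzf)
  have hBac : AbsolutelyContinuousOnInterval B 0 1 := ac_integral hφf
  -- Variation of constants without dividing by the Wronskian `c`: the terms with `A'` and `B'`
  -- cancel in the first equation and leave `-f (z ψ - w φ) = -c f` in the second.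
  have hsol : IsSol r 1 (realCoeff p r m) (-r) 0 (fun x => -c * f x)
      (fun x => φ x * A x + z x * B x) (fun x => ψ x * A x + w x * B x) := by
    refine ⟨(h'.ac_y.mul hAac).add (h.ac_y.mul hBac), (h'.ac_w.mul hAac).add (h.ac_w.mul hBac),
      ?_, ?_⟩
    · filter_upwards [h.deriv_y, h'.deriv_y, ae_hasDerivAt_integral zero_le_one hzf,
        ae_hasDerivAt_integral zero_le_one hφf] with x e1 e2 e3 e4
      refine ((e2.mul (e3.const_sub _)).add (e1.mul e4)).congr_deriv ?_
      simp only [Pi.zero_apply, Pi.one_apply, hA_def, hB_def]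
      ring
    · filter_upwards [h.deriv_w, h'.deriv_w, ae_hasDerivAt_integral zero_le_one hzf,
        ae_hasDerivAt_integral zero_le_one hφf, ae_of_forall_Icc hW] with x e1 e2 e3 e4 e5
      refine ((e2.mul (e3.const_sub _)).add (e1.mul e4)).congr_deriv ?_
      simp only [Pi.zero_apply, hA_def, hB_def]
      linear_combination -f x * e5
  have hA' : ∀ x ∈ Icc (0 : ℝ) 1, A x = ∫ t in x..1, f t * z t := fun x hx => by
    have hx' : x ∈ uIcc (0 : ℝ) 1 := by rwa [uIcc_of_le zero_le_one]
    rw [hA_def]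
    exact intervalIntegral.integral_interval_sub_left hzf (intervalIntegrable_zero_left hzf hx)
  have hpos : 0 ≤ ∫ x, (-c * f x) * (φ x * A x + z x * B x) ∂vol01 := by
    refine integral_nonneg_of_ae (ae_of_forall_Icc fun x hx => ?_)
    by_cases hxb : x ∈ Metric.ball x₀ ε
    · have h1 : 0 ≤ -c * φ x * A x := by
        rw [hA' x hx, ← intervalIntegral.integral_const_mul]
        refine intervalIntegral.integral_nonneg hx.2 fun t _ => ?_
        by_cases ht : t ∈ Metric.ball x₀ ε
        · have := mul_nonneg (hf0 t) (neg_nonneg.2 (hball x hxb t ht).2.le)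
          linarith
        · simp [hf_def, ht]
      have h2 : 0 ≤ -c * z x * B x := by
        rw [hB_def, ← intervalIntegral.integral_const_mul]
        refine intervalIntegral.integral_nonneg hx.1 fun t _ => ?_
        by_cases ht : t ∈ Metric.ball x₀ ε
        · have := mul_nonneg (hf0 t) (neg_nonneg.2 (hball t ht x hxb).2.le)
          linarith
        · simp [hf_def, ht]
      have h3 := mul_nonneg (hf0 x) (add_nonneg h1 h2)
      simp only [Pi.zero_apply]
      linarith
    · simp [hf_def, hxb]
  -- Negativity forces this solution to vanish, hence `c f = 0` almost everywhere, although `f = 1`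
  -- on a ball.
  have hy := eqOn_zero_of_isNegative hp hA (hfm.const_mul (-c)) hsol
    (by simp [hφ, hB_def]) (by simp [hw, hA_def]) hpos
  have hw' := hsol.snd_eq_zero hy
  have hsub : Ioo (x₀ - ε) (x₀ + ε) ⊆ Icc (0 : ℝ) 1 := fun s hs =>
    (hball s (by rwa [Real.ball_eq_Ioo]) s (by rwa [Real.ball_eq_Ioo])).1
  -- Closures turn the inclusion of the open interval into bounds on its endpoints.
  have hcl := closure_mono hsub
  rw [closure_Ioo (by linarith), isClosed_Icc.closure_eq] at hcl
  refine not_ae_notMem_Ioo (hcl (left_mem_Icc.2 (by linarith))).1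
    (by linarith : x₀ - ε < x₀ + ε) (hcl (right_mem_Icc.2 (by linarith))).2 ?_
  filter_upwards [hsol.deriv_w, ae_restrict_mem measurableSet_Ioo] with x hx hm hmem
  have e := hasDerivAt_eq_zero hw' hm hx
  have e1 := hy (Ioo_subset_Icc_self hm)
  have e2 := hw' (Ioo_subset_Icc_self hm)
  simp only [Pi.zero_apply] at e1 e2
  rw [e1, e2, hf_def, indicator_of_mem (by rwa [Real.ball_eq_Ioo])] at e
  exact hz0 (by simpa using e)

/-- Solutions of the Miura equation are positive if the pencil is negative at `m`. -/
theorem isMiuraSolution_pos {p r : ℝ → ℝ} (hp : MemLp p 2 vol01) (hr : MemLp r 2 vol01) {m : ℝ}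
    (hA : IsNegative (pencil p r BC.one m)) {z w : ℝ → ℝ}
    (h : IsSol r 1 (realCoeff p r m) (-r) 0 0 z w) (hz : z 1 = 1) (hw : w 1 = 0) :
    ∀ x ∈ Icc (0 : ℝ) 1, 0 < z x := by
  have ha := hr.integrable one_le_two
  have hb : Integrable (1 : ℝ → ℝ) vol01 := integrable_const 1
  have hc := integrable_realCoeff hp hr m
  have h0 : Integrable (0 : ℝ → ℝ) vol01 := integrable_zero _ _ _
  have h11 : (1 : ℝ) ∈ Icc (0 : ℝ) 1 := right_mem_Icc.2 zero_le_one
  obtain ⟨φ, ψ, h', hφ, hψ⟩ := exists_isSol ha hb hc ha.neg h0 h0 0 1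
  -- Otherwise `z` would satisfy both boundary conditions and lie in the kernel of `T_1(m)`.
  have hz0 : z 0 ≠ 0 := fun hz0 => by
    have := eqOn_zero_of_isNegative hp hA (MemLp.zero (ε := ℝ)) h hz0 hw (by simp) h11
    simp [hz] at this
  have hgreen := green_diagonal_nonneg hp hA h h' hw hφ hψ hz0
  have hW : ∀ x ∈ Icc (0 : ℝ) 1, z x * ψ x - w x * φ x = z 0 := fun x hx => by
    rw [h.wronskian h' x hx, hφ, hψ]; ring
  have hne : ∀ x ∈ Icc (0 : ℝ) 1, z x ≠ 0 := by
    intro a haI hza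
    have ha0 : 0 < a := haI.1.lt_of_ne fun e => hz0 ((congrArg z e).trans hza)
    have ha1 : a < 1 := haI.2.lt_of_ne fun e => by rw [e, hz] at hza; exact one_ne_zero hza
    have hφa : φ a ≠ 0 := fun e => hz0 (by rw [← hW a haI, e, hza]; ring)
    have hφcont := (continuousOn_Icc_of_ac h'.ac_y).continuousAt (Icc_mem_nhds ha0 ha1)
    obtain ⟨ε, hε, hball⟩ := Metric.eventually_nhds_iff_ball.1 (hφcont.eventually_ne hφa)
    obtain ⟨b, hab, hb⟩ := exists_between (lt_min (by linarith : a < a + ε) ha1)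
    rw [lt_min_iff] at hb
    have hsub : Icc a b ⊆ Icc (0 : ℝ) 1 := Icc_subset_Icc ha0.le hb.2.le
    have hsub' : uIcc a b ⊆ uIcc (0 : ℝ) 1 := by
      rwa [uIcc_of_le hab.le, uIcc_of_le zero_le_one]
    have hφne : ∀ x ∈ Icc a b, φ x ≠ 0 := fun x hx => by
      refine hball x ?_
      rw [Real.ball_eq_Ioo]
      exact ⟨by linarith [hx.1], by linarith [hx.2]⟩
    have hinv := ac_inv (h'.ac_y.mono hsub') (by rwa [uIcc_of_le hab.le])
    have hcont : ContinuousOn (fun x => (φ x)⁻¹ ^ 2) (Icc a b) := by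
      have := (hinv.continuousOn).pow 2
      rwa [uIcc_of_le hab.le] at this
    have hI : IntervalIntegrable (fun x => (φ x)⁻¹ ^ 2) volume a b :=
      ContinuousOn.intervalIntegrable (by rwa [uIcc_of_le hab.le])
    have hmono : vol01.restrict (Ioo a b) = volume.restrict (Ioo a b) := by
      rw [Measure.restrict_restrict measurableSet_Ioo,
        inter_eq_left.2 (Ioo_subset_Ioo ha0.le hb.2.le)]
    -- To the right of a zero `a` of `z`, where `φ` stays nonzero, the Wronskian identity is the
    -- derivative of `z / φ`.
    have hd : ∀ᵐ x ∂volume.restrict (Ioo a b),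
        HasDerivAt (fun x => z x * (φ x)⁻¹) (-z 0 * (φ x)⁻¹ ^ 2) x := by
      have e1 := ae_restrict_of_ae (s := Ioo a b) h.deriv_y
      have e2 := ae_restrict_of_ae (s := Ioo a b) h'.deriv_y
      rw [hmono] at e1 e2
      filter_upwards [e1, e2, ae_restrict_mem measurableSet_Ioo] with x e1 e2 hm
      have hx := Ioo_subset_Icc_self hm
      refine (e1.mul (e2.inv (hφne x hx))).congr_deriv ?_
      have := hφne x hx
      rw [← hW x (hsub hx)]
      simp only [Pi.zero_apply, Pi.one_apply, Pi.inv_apply]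
      field_simp
      ring
    have key := eq_add_integral_of_ac hab.le ((h.ac_y.mono hsub').mul hinv) hd (hI.const_mul _)
      (right_mem_Icc.2 hab.le)
    rw [intervalIntegral.integral_const_mul] at key
    have hpos : 0 < ∫ x in a..b, (φ x)⁻¹ ^ 2 :=
      intervalIntegral.intervalIntegral_pos_of_pos_on hI
        (fun x hx => by
          have := hφne x (Ioo_subset_Icc_self hx)
          positivity) hab
    have hbI : b ∈ Icc a b := right_mem_Icc.2 hab.le
    have hφb := hφne b hbI
    have e : z b = -z 0 * (∫ x in a..b, (φ x)⁻¹ ^ 2) * φ b := by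
      have : z b * (φ b)⁻¹ = -z 0 * ∫ x in a..b, (φ x)⁻¹ ^ 2 := by
        simpa [hza] using key
      rw [← this]
      field_simp
    -- The diagonal value at `b` equals `-z(0)² φ(b)² ∫ φ⁻² < 0`, against `hgreen`.
    have hg := hgreen b ⟨by linarith, hb.2⟩
    rw [e] at hg
    have h1 : 0 < z 0 ^ 2 * φ b ^ 2 * ∫ x in a..b, (φ x)⁻¹ ^ 2 := by positivity
    nlinarith
  intro x hx
  by_contra! hle
  have hzc := (continuousOn_Icc_of_ac h.ac_y).mono (Icc_subset_Icc_left hx.1)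
  obtain ⟨t, ht, ht0⟩ := intermediate_value_Icc hx.2 hzc ⟨hle, by rw [hz]; exact zero_le_one⟩
  exact hne t ⟨hx.1.trans ht.1, ht.2⟩ ht0

/-! ### The Miura factorization -/

section Miura

variable {p r z w : ℝ → ℝ} {m : ℝ}

/-- The absolutely continuous quotient `z^{[1]} / z`. -/
noncomputable def quasiLog (z w : ℝ → ℝ) (x : ℝ) : ℝ := w x * (z x)⁻¹

/-- This splits `v` into the rough part `r` and an absolutely continuous part, which has pointwise
values and a derivative almost everywhere. -/
theorem miuraV_ae_eq (h : IsSol r 1 (realCoeff p r m) (-r) 0 0 z w)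
    (hpos : ∀ x ∈ Icc (0 : ℝ) 1, 0 < z x) :
    ∀ᵐ x ∂vol01, miuraV z x = r x + quasiLog z w x := by
  filter_upwards [h.deriv_y, ae_of_forall_Icc hpos] with x hx hz
  rw [miuraV, hx.deriv, quasiLog]
  simp only [Pi.one_apply, Pi.zero_apply]
  field_simp
  ring

theorem quasiLog_ac (h : IsSol r 1 (realCoeff p r m) (-r) 0 0 z w)
    (hpos : ∀ x ∈ Icc (0 : ℝ) 1, 0 < z x) :
    AbsolutelyContinuousOnInterval (quasiLog z w) 0 1 := by
  refine h.ac_w.mul (ac_inv h.ac_y ?_)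
  rw [uIcc_of_le zero_le_one]
  exact fun x hx => (hpos x hx).ne'

theorem memLp_miuraV (hr : MemLp r 2 vol01) (h : IsSol r 1 (realCoeff p r m) (-r) 0 0 z w)
    (hpos : ∀ x ∈ Icc (0 : ℝ) 1, 0 < z x) : MemLp (miuraV z) 2 vol01 :=
  (memLp_congr_ae (miuraV_ae_eq h hpos)).2 (hr.add (memLp_of_ac (quasiLog_ac h hpos)))

/-- The Riccati equation. -/
theorem quasiLog_deriv (h : IsSol r 1 (realCoeff p r m) (-r) 0 0 z w)
    (hpos : ∀ x ∈ Icc (0 : ℝ) 1, 0 < z x) :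
    ∀ᵐ x ∂vol01, HasDerivAt (quasiLog z w)
      (-(m ^ 2 - 2 * m * p x) - (r x + quasiLog z w x) ^ 2) x := by
  filter_upwards [h.deriv_y, h.deriv_w, ae_of_forall_Icc hpos] with x e1 e2 hz
  refine (e2.mul (e1.inv hz.ne')).congr_deriv ?_
  simp only [quasiLog, realCoeff, Pi.one_apply, Pi.zero_apply, Pi.neg_apply, Pi.inv_apply]
  field_simp
  ring

theorem cx_quasiLog_deriv (h : IsSol r 1 (realCoeff p r m) (-r) 0 0 z w)
    (hpos : ∀ x ∈ Icc (0 : ℝ) 1, 0 < z x) :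
    ∀ᵐ x ∂vol01, HasDerivAt (cx (quasiLog z w))
      (-((m : ℂ) ^ 2 - 2 * m * p x) - (r x + cx (quasiLog z w) x) ^ 2) x := by
  filter_upwards [quasiLog_deriv h hpos] with x hx
  exact hx.ofReal_comp.congr_deriv (by simp [cx])

/-- Solutions of the Dirac system yield solutions of the pencil. -/
theorem isSol_pencil_of_dirac (h : IsSol r 1 (realCoeff p r m) (-r) 0 0 z w)
    (hpos : ∀ x ∈ Icc (0 : ℝ) 1, 0 < z x) {l : ℂ} {y u : ℝ → ℂ}
    (hD : IsSol (cx (miuraV z)) (fun _ => l - m) (diracCoeff p m l) (-cx (miuraV z)) 0 0 y u) :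
    IsSol (cx r) 1 (pencilCoeff p r l) (-cx r) 0 0 y
      (fun x => (l - m) * u x + cx (quasiLog z w) x * y x) := by
  refine ⟨hD.ac_y, (hD.ac_w.const_smul (l - m)).add
    ((ac_ofReal (quasiLog_ac h hpos)).fun_smul hD.ac_y), ?_, ?_⟩
  · filter_upwards [hD.deriv_y, miuraV_ae_eq h hpos] with x e1 e2
    refine e1.congr_deriv ?_
    simp only [cx, e2, Pi.one_apply, Pi.zero_apply, Complex.ofReal_add]
    ring
  · filter_upwards [hD.deriv_y, hD.deriv_w, miuraV_ae_eq h hpos, cx_quasiLog_deriv h hpos]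
      with x e1 e2 e3 e4
    -- By the Riccati equation the coefficient of `y` collapses through `(l - m)(2p - m - l) - (m² -
    -- 2 m p) = 2 l p - l²`. No `l ≠ m` is needed, so this direction also serves at `l = m`.
    refine ((e2.const_mul (l - m)).add (e4.mul e1)).congr_deriv ?_
    simp only [cx, e3, Pi.zero_apply, Pi.neg_apply, Complex.ofReal_add, pencilCoeff, diracCoeff]
    ring

/-- Solutions of the pencil yield solutions of the Dirac system. -/
theorem isSol_dirac_of_pencil (h : IsSol r 1 (realCoeff p r m) (-r) 0 0 z w)
    (hpos : ∀ x ∈ Icc (0 : ℝ) 1, 0 < z x) {l : ℂ} (hl : l ≠ m) {y u : ℝ → ℂ}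
    (hT : IsSol (cx r) 1 (pencilCoeff p r l) (-cx r) 0 0 y u) :
    IsSol (cx (miuraV z)) (fun _ => l - m) (diracCoeff p m l) (-cx (miuraV z)) 0 0 y
      (fun x => (l - m)⁻¹ * (u x - cx (quasiLog z w) x * y x)) := by
  have hl' : l - m ≠ 0 := sub_ne_zero.2 hl
  refine ⟨hT.ac_y, (hT.ac_w.fun_sub
    ((ac_ofReal (quasiLog_ac h hpos)).fun_smul hT.ac_y)).const_smul (l - m)⁻¹, ?_, ?_⟩
  · filter_upwards [hT.deriv_y, miuraV_ae_eq h hpos] with x e1 e2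
    refine e1.congr_deriv ?_
    simp only [cx, e2, Pi.one_apply, Pi.zero_apply, Complex.ofReal_add]
    field_simp
    ring
  · filter_upwards [hT.deriv_y, hT.deriv_w, miuraV_ae_eq h hpos, cx_quasiLog_deriv h hpos]
      with x e1 e2 e3 e4
    refine ((e2.sub (e4.mul e1)).const_mul (l - m)⁻¹).congr_deriv ?_
    simp only [cx, e3, Pi.zero_apply, Pi.one_apply, Pi.neg_apply, Complex.ofReal_add, pencilCoeff,
      diracCoeff]
    field_simp
    ring

/-- The homogeneous problem for the pencil at `m` has only the trivial solution. -/
theorem pencil_injective_at (h : IsSol r 1 (realCoeff p r m) (-r) 0 0 z w)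
    (hpos : ∀ x ∈ Icc (0 : ℝ) 1, 0 < z x) (hw : w 1 = 0) {j : BC} {y u : ℝ → ℂ}
    (hT : IsSol (cx r) 1 (pencilCoeff p r m) (-cx r) 0 0 y u) (hy : y 0 = 0)
    (hj : j.pick (u 1) (y 1) = 0) : u 0 = 0 := by
  have h01 : (0 : ℝ) ∈ Icc (0 : ℝ) 1 := left_mem_Icc.2 zero_le_one
  have h11 : (1 : ℝ) ∈ Icc (0 : ℝ) 1 := right_mem_Icc.2 zero_le_one
  have hsol : IsSol (cx r) 1 (pencilCoeff p r m) (-cx r) 0 0 (cx z) (cx w) := by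
    have h' := h.cx
    rw [cx_realCoeff] at h'
    exact h'.congr_ae (Eventually.of_forall fun x => by simp [cx])
      (Eventually.of_forall fun x => by simp [cx])
  -- For `j = one` this Wronskian with `z` vanishes at `1`. For `j = two` it gives `(y/z)' = z(0)
  -- u(0) / z²`, and `y/z` vanishes at both ends.
  have hW : ∀ x ∈ Icc (0 : ℝ) 1, z x * u x - w x * y x = z 0 * u 0 := fun x hx => by
    have := hsol.wronskian hT x hx
    simpa [cx, hy] using this
  have hz0 : (z 0 : ℂ) ≠ 0 := by exact_mod_cast (hpos 0 h01).ne'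
  suffices hc : (z 0 : ℂ) * u 0 = 0 from (mul_eq_zero.1 hc).resolve_left hz0
  cases j with
  | one =>
    have hu : u 1 = 0 := hj
    rw [← hW 1 h11, hu, hw]
    simp
  | two =>
    have hy1 : y 1 = 0 := hj
    have hinv : AbsolutelyContinuousOnInterval (fun x => (z x)⁻¹) 0 1 := by
      refine ac_inv h.ac_y ?_
      rw [uIcc_of_le zero_le_one]
      exact fun x hx => (hpos x hx).ne'
    have hI : IntervalIntegrable (fun x => (z x)⁻¹ ^ 2) volume 0 1 :=
      (hinv.continuousOn.pow 2).intervalIntegrable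
    have hd : ∀ᵐ x ∂vol01, HasDerivAt (fun x => ((z x)⁻¹ : ℝ) • y x)
        (((z x)⁻¹ ^ 2 : ℝ) • (z 0 * u 0 : ℂ)) x := by
      filter_upwards [h.deriv_y, hT.deriv_y, ae_of_forall_Icc hpos, ae_of_forall_Icc hW]
        with x e1 e2 hz hWx
      refine ((e1.inv hz.ne').smul e2).congr_deriv ?_
      have hz' : (z x : ℂ) ≠ 0 := by exact_mod_cast hz.ne'
      rw [← hWx]
      simp only [Pi.one_apply, Pi.zero_apply, Pi.inv_apply, Complex.real_smul, cx]
      push_cast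
      field_simp
      ring
    have key := eq_add_integral_of_ac zero_le_one (hinv.fun_smul hT.ac_y) hd
      ⟨hI.1.smul_const _, hI.2.smul_const _⟩ h11
    rw [hy, hy1, smul_zero, smul_zero, zero_add, intervalIntegral.integral_smul_const] at key
    have hpos' : 0 < ∫ x in (0 : ℝ)..1, (z x)⁻¹ ^ 2 :=
      intervalIntegral.intervalIntegral_pos_of_pos_on hI (fun x hx => by
        have := hpos x (Ioo_subset_Icc_self hx)
        positivity) zero_lt_one
    exact (smul_eq_zero.1 key.symm).resolve_left hpos'.ne'

/-! ### Transfer of boundary conditions, spectra and eigenfunctions -/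

theorem quasiLog_one (hw : w 1 = 0) : cx (quasiLog z w) 1 = 0 := by simp [cx, quasiLog, hw]

/-- As `z^{[1]}(1) = 0`, the quasi-derivative of `y` at `1` is `(l - m) u₁(1)`, so the conditions
for `j = one` agree; those for `j = two` involve only `y`. -/
theorem pick_dirac_to_pencil (hw : w 1 = 0) {j : BC} {l a b : ℂ} (h : j.pick a b = 0) :
    j.pick ((l - m) * a + cx (quasiLog z w) 1 * b) b = 0 := by
  rw [quasiLog_one hw, zero_mul, add_zero]
  cases j with
  | one => exact mul_eq_zero_of_right _ h
  | two => exact h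

theorem pick_pencil_to_dirac (hw : w 1 = 0) {j : BC} {l a b : ℂ} (h : j.pick a b = 0) :
    j.pick ((l - m)⁻¹ * (a - cx (quasiLog z w) 1 * b)) b = 0 := by
  rw [quasiLog_one hw, zero_mul, sub_zero]
  cases j with
  | one => exact mul_eq_zero_of_right _ h
  | two => exact h

theorem dirac_boundedlyInvertible_iff_pencil (hp : MemLp p 2 vol01) (hr : MemLp r 2 vol01)
    (h : IsSol r 1 (realCoeff p r m) (-r) 0 0 z w) (hpos : ∀ x ∈ Icc (0 : ℝ) 1, 0 < z x)
    (hw : w 1 = 0) {j : BC} {l : ℂ} (hl : l ≠ m) :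
    BoundedlyInvertible (diracOp (miuraP p m z) j - l • idOp L2xL2) ↔
      BoundedlyInvertible (pencil p r j l) := by
  have hl' : l - m ≠ 0 := sub_ne_zero.2 hl
  rw [dirac_boundedlyInvertible_iff hp (memLp_miuraV hr h hpos),
    pencil_boundedlyInvertible_iff hp hr]
  constructor
  · intro hD y u hT hy hj
    have := hD _ _ (isSol_dirac_of_pencil h hpos hl hT) hy (pick_pencil_to_dirac hw hj)
    simpa [hy, hl'] using this
  · intro hT y u hD hy hj
    have := hT _ _ (isSol_pencil_of_dirac h hpos hD) hy (pick_dirac_to_pencil hw hj)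
    simpa [hy, hl'] using this

theorem pencil_boundedlyInvertible_at (hp : MemLp p 2 vol01) (hr : MemLp r 2 vol01)
    (h : IsSol r 1 (realCoeff p r m) (-r) 0 0 z w) (hpos : ∀ x ∈ Icc (0 : ℝ) 1, 0 < z x)
    (hw : w 1 = 0) (j : BC) : BoundedlyInvertible (pencil p r j m) :=
  (pencil_boundedlyInvertible_iff hp hr).2 fun _ _ hT hy hj => pencil_injective_at h hpos hw hT hy hj

/-- At `l = m` the equation for `y` decouples to `y' = v y`, so `y = 0`. Then `u' = -v u` makes `z
u` constant, and `u(1) = 0` kills it. -/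
theorem dirac_boundedlyInvertible_one (hp : MemLp p 2 vol01) (hr : MemLp r 2 vol01)
    (h : IsSol r 1 (realCoeff p r m) (-r) 0 0 z w) (hpos : ∀ x ∈ Icc (0 : ℝ) 1, 0 < z x) :
    BoundedlyInvertible (diracOp (miuraP p m z) BC.one - (m : ℂ) • idOp L2xL2) := by
  rw [dirac_boundedlyInvertible_iff hp (memLp_miuraV hr h hpos)]
  intro y u hD hy hj
  have hu : u 1 = 0 := hj
  have h01 : (0 : ℝ) ∈ Icc (0 : ℝ) 1 := left_mem_Icc.2 zero_le_one
  have h11 : (1 : ℝ) ∈ Icc (0 : ℝ) 1 := right_mem_Icc.2 zero_le_one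
  have ha := integrable_cx (hr.integrable one_le_two)
  have hy0 := (isSol_pencil_of_dirac h hpos hD).eq_zero ha (integrable_const 1)
    (integrable_pencilCoeff hp hr m) ha.neg hy (by simp [hy])
  have hconst : ∀ x ∈ Icc (0 : ℝ) 1, z x • u x = z 0 • u 0 := fun x hx => by
    refine eqOn_const_of_ac zero_le_one (h.ac_y.fun_smul hD.ac_w) ?_ hx
    filter_upwards [h.deriv_y, hD.deriv_w, miuraV_ae_eq h hpos, ae_of_forall_Icc hpos,
      ae_of_forall_Icc hy0] with x e1 e2 e3 hz e5
    refine (e1.smul e2).congr_deriv ?_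
    have hz' : (z x : ℂ) ≠ 0 := by exact_mod_cast hz.ne'
    simp only [e5.1, cx, e3, quasiLog, Pi.one_apply, Pi.zero_apply, Pi.neg_apply,
      Complex.real_smul]
    push_cast
    field_simp
    ring
  have := hconst 1 h11
  rw [hu, smul_zero] at this
  exact (smul_eq_zero.1 this.symm).resolve_left (hpos 0 h01).ne'

/-- The pair `u₁ = 1/z`, `u₂ = 0` lies in the kernel, as both boundary conditions concern `u₂` only.
-/
theorem not_dirac_boundedlyInvertible_two (hp : MemLp p 2 vol01) (hr : MemLp r 2 vol01)
    (h : IsSol r 1 (realCoeff p r m) (-r) 0 0 z w) (hpos : ∀ x ∈ Icc (0 : ℝ) 1, 0 < z x) :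
    ¬ BoundedlyInvertible (diracOp (miuraP p m z) BC.two - (m : ℂ) • idOp L2xL2) := by
  rw [dirac_boundedlyInvertible_iff hp (memLp_miuraV hr h hpos)]
  intro hD
  have h01 : (0 : ℝ) ∈ Icc (0 : ℝ) 1 := left_mem_Icc.2 zero_le_one
  have hinv : AbsolutelyContinuousOnInterval (fun x => (z x)⁻¹) 0 1 := by
    refine ac_inv h.ac_y ?_
    rw [uIcc_of_le zero_le_one]
    exact fun x hx => (hpos x hx).ne'
  have := hD 0 (cx fun x => (z x)⁻¹) ⟨ac_zero, ac_ofReal hinv, ?_, ?_⟩ rfl rfl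
  · have hz := (hpos 0 h01).ne'
    simp [cx] at this
    exact hz this
  · exact Eventually.of_forall fun x => (hasDerivAt_const x (0 : ℂ)).congr_deriv (by simp)
  · filter_upwards [h.deriv_y, miuraV_ae_eq h hpos, ae_of_forall_Icc hpos] with x e1 e2 hz
    refine (e1.inv hz.ne').ofReal_comp.congr_deriv ?_
    have hz' : (z x : ℂ) ≠ 0 := by exact_mod_cast hz.ne'
    simp only [cx, e2, quasiLog, Pi.one_apply, Pi.zero_apply, Pi.neg_apply]
    push_cast
    field_simp
    ring

theorem isPencilEigenfunction_iff_dirac (hp : MemLp p 2 vol01) (hr : MemLp r 2 vol01)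
    (h : IsSol r 1 (realCoeff p r m) (-r) 0 0 z w) (hpos : ∀ x ∈ Icc (0 : ℝ) 1, 0 < z x)
    (hw : w 1 = 0) {j : BC} {l : ℂ} {y : ℝ → ℂ} (hy : AbsolutelyContinuousOnInterval y 0 1) :
    IsPencilEigenfunction p r j l y ↔ l ≠ m ∧ IsDiracEigenfunction (miuraP p m z) j l
      (fun x => (deriv y x - (miuraV z x : ℂ) * y x) / (l - m)) y := by
  rw [isPencilEigenfunction_iff hp hr hy,
    isDiracEigenfunction_iff hp (memLp_miuraV hr h hpos) hy]
  constructor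
  · rintro ⟨u, hT, h0, h1, hne⟩
    -- At `m` the pencil has no kernel, so an eigenfunction excludes `l = m`.
    have hl : l ≠ m := by
      rintro rfl
      exact hne (pencil_injective_at h hpos hw hT h0 h1)
    have hl' : l - m ≠ 0 := sub_ne_zero.2 hl
    refine ⟨hl, _, ?_, isSol_dirac_of_pencil h hpos hl hT, h0, pick_pencil_to_dirac hw h1, ?_⟩
    · filter_upwards [hT.deriv_y, miuraV_ae_eq h hpos] with x e1 e2
      rw [e1.deriv, e2]
      simp only [cx, Pi.one_apply, Pi.zero_apply, Complex.ofReal_add]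
      field_simp
      ring
    · simpa [h0, hl'] using hne
  · rintro ⟨hl, u, -, hD, h0, h1, hne⟩
    have hl' : l - m ≠ 0 := sub_ne_zero.2 hl
    exact ⟨_, isSol_pencil_of_dirac h hpos hD, h0, pick_dirac_to_pencil hw h1,
      by simpa [h0, hl'] using hne⟩

end Miura

end EnergyPencil

theorem mainTheorem4 (p r : ℝ → ℝ)
    (hp : MemLp p 2 EnergyPencil.vol01) (hr : MemLp r 2 EnergyPencil.vol01) (m : ℝ)
    (hA : EnergyPencil.IsNegative (EnergyPencil.pencil p r EnergyPencil.BC.one (m : ℂ))) :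
    (∃ z : ℝ → ℝ, EnergyPencil.IsMiuraSolution p r m z) ∧
    ∀ z : ℝ → ℝ, EnergyPencil.IsMiuraSolution p r m z →
      (∀ x ∈ Set.Icc (0 : ℝ) 1, 0 < z x) ∧
      EnergyPencil.opSpectrum
          (EnergyPencil.diracOp (EnergyPencil.miuraP p m z) EnergyPencil.BC.one) =
        EnergyPencil.pencilSpectrum (EnergyPencil.pencil p r EnergyPencil.BC.one) ∧
      EnergyPencil.opSpectrum
          (EnergyPencil.diracOp (EnergyPencil.miuraP p m z) EnergyPencil.BC.two) =
        EnergyPencil.pencilSpectrum (EnergyPencil.pencil p r EnergyPencil.BC.two) ∪ {(m : ℂ)} ∧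
      ∀ (j : EnergyPencil.BC) (l : ℂ) (y : ℝ → ℂ), AbsolutelyContinuousOnInterval y 0 1 →
        (EnergyPencil.IsPencilEigenfunction p r j l y ↔
          l ≠ (m : ℂ) ∧
          EnergyPencil.IsDiracEigenfunction (EnergyPencil.miuraP p m z) j l
            (fun x => (deriv y x - (EnergyPencil.miuraV z x : ℂ) * y x) / (l - (m : ℂ))) y) := by
  refine ⟨EnergyPencil.exists_isMiuraSolution hp hr m, ?_⟩
  rintro z ⟨w, hell, hz1, hw1⟩
  have h := EnergyPencil.isEll_iff_isSol.1 hell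
  have hpos := EnergyPencil.isMiuraSolution_pos hp hr hA h hz1 hw1
  refine ⟨hpos, ?_, ?_, fun j l y hy =>
    EnergyPencil.isPencilEigenfunction_iff_dirac hp hr h hpos hw1 hy⟩
  · ext l
    rw [EnergyPencil.mem_opSpectrum_iff, EnergyPencil.mem_pencilSpectrum_iff]
    by_cases hl : l = m
    · subst hl
      exact not_congr (iff_of_true (EnergyPencil.dirac_boundedlyInvertible_one hp hr h hpos)
        (EnergyPencil.pencil_boundedlyInvertible_at hp hr h hpos hw1 _))
    · rw [EnergyPencil.dirac_boundedlyInvertible_iff_pencil hp hr h hpos hw1 hl]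
  · ext l
    rw [EnergyPencil.mem_opSpectrum_iff, Set.mem_union, EnergyPencil.mem_pencilSpectrum_iff,
      Set.mem_singleton_iff]
    by_cases hl : l = m
    · subst hl
      exact iff_of_true (EnergyPencil.not_dirac_boundedlyInvertible_two hp hr h hpos) (Or.inr rfl)
    · rw [EnergyPencil.dirac_boundedlyInvertible_iff_pencil hp hr h hpos hw1 hl]
      simp [hl]
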